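/- Let $\Bbbk$ be an algebraically closed field (of any characteristic), let $S$ be a $\Bbbk$-scheme that is smooth of relative dimension $2$ (for example a smooth projective surface over $\Bbbk$), and let $E$ be a locally free sheaf of rank $2$ on $S$. Let $\pi\colon \mathbb P(E)\to S$ be the projective bundle parametrizing invertible quotients of $E$, with tautological quotient $\pi^*E\to\mathcal O_{\mathbb P(E)}(1)$. Assume that $E$ is very ample, i.e. that the line bundle $\mathcal O_{\mathbb P(E)}(1)$ is very ample over $\Bbbk$: there are an integer $n\ge 0$ and an immersion $\varphi\colon\mathbb P(E)\to\mathbb P^n_{\Bbbk}$ over $\Bbbk$ with $\varphi^*\mathcal O(1)\cong\mathcal O_{\mathbb P(E)}(1)$. Then $\det E=\bigwedge^2E$ is $2$-jet ample: for all distinct closed points $x_1,\dots,x_r\in S$ and all positive integers $k_1,\dots,k_r$ with $k_1+\dots+k_r=3$, the natural map $$H^0(S,\det E)\longrightarrow\bigoplus_{i=1}^r (\det E)_{x_i}/\mathfrak m_{x_i}^{k_i}(\det E)_{x_i}$$ is surjective. -/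

import Mathlib

open CategoryTheory AlgebraicGeometry TopologicalSpace Opposite

universe u

attribute [local instance] MvPolynomial.gradedAlgebra

noncomputable section

/-! ### Exterior powers along semilinear maps -/

namespace exteriorPower

variable {R R' R'' : Type u} [CommRing R] [CommRing R'] [CommRing R''] {M N K : Type u}
  [AddCommGroup M] [Module R M] [AddCommGroup N] [Module R' N] [AddCommGroup K] [Module R'' K]

/-- The additive map `⋀ⁿ M → ⋀ⁿ N`, `m₁ ∧ ⋯ ∧ mₙ ↦ f m₁ ∧ ⋯ ∧ f mₙ`, induced by a map `f` that is
semilinear with respect to a homomorphism `φ` of commutative rings. It is itself semilinear. -/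
def mapSemilinear (φ : R →+* R') (f : M →ₛₗ[φ] N) (n : ℕ) : (⋀[R]^n M) →ₛₗ[φ] (⋀[R']^n N) :=
  letI : Module R (⋀[R']^n N) := Module.compHom _ φ
  let g : M [⋀^Fin n]→ₗ[R] (⋀[R']^n N) :=
    { toFun := fun m ↦ ιMulti R' n (fun i ↦ f (m i))
      map_update_add' := fun {inst} m i x y ↦ by
        have h : ∀ z : M, (fun j ↦ f (Function.update m i z j)) =
            Function.update (fun j ↦ f (m j)) i (f z) := fun z ↦ by
          ext j; by_cases hj : j = i
          · subst hj; simp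
          · simp [hj]
        rw [h, h, h, map_add, AlternatingMap.map_update_add]
      map_update_smul' := fun {inst} m i r x ↦ by
        have h : ∀ z : M, (fun j ↦ f (Function.update m i z j)) =
            Function.update (fun j ↦ f (m j)) i (f z) := fun z ↦ by
          ext j; by_cases hj : j = i
          · subst hj; simp
          · simp [hj]
        rw [h, h, f.map_smulₛₗ, AlternatingMap.map_update_smul]
        rfl
      map_eq_zero_of_eq' := fun m i j hm hij ↦
        (ιMulti R' n).map_eq_zero_of_eq _ (by simp [hm]) hij }
  { toFun := alternatingMapLinearEquiv g
    map_add' := map_add _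
    map_smul' := fun r x ↦ (alternatingMapLinearEquiv g).map_smul r x }

lemma mapSemilinear_ιMulti (φ : R →+* R') (f : M →ₛₗ[φ] N) (n : ℕ) (m : Fin n → M) :
    mapSemilinear φ f n (ιMulti R n m) = ιMulti R' n (fun i ↦ f (m i)) := by
  let : Module R (⋀[R']^n N) := Module.compHom _ φ
  exact alternatingMapLinearEquiv_apply_ιMulti _ _

lemma induction_ιMulti {n : ℕ} {p : (⋀[R]^n M) → Prop} (h : ∀ m, p (ιMulti R n m)) (h0 : p 0)
    (hadd : ∀ x y, p x → p y → p (x + y)) (hsmul : ∀ (r : R) x, p x → p (r • x))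
    (x : ⋀[R]^n M) : p x := by
  have hx : x ∈ Submodule.span R (Set.range (ιMulti R n (M := M))) := by
    rw [ιMulti_span]; trivial
  induction hx using Submodule.span_induction with
  | mem y hy => obtain ⟨m, rfl⟩ := hy; exact h m
  | zero => exact h0
  | add y z _ _ hy hz => exact hadd y z hy hz
  | smul r y _ hy => exact hsmul r y hy

lemma mapSemilinear_id {M : Type u} [AddCommGroup M] [Module R M] (φ : R →+* R)
    (hφ : ∀ r, φ r = r) (f : M →ₛₗ[φ] M) (hf : ∀ m, f m = m) (n : ℕ) (x : ⋀[R]^n M) :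
    mapSemilinear φ f n x = x := by
  induction x using induction_ιMulti with
  | h m => rw [mapSemilinear_ιMulti]; simp only [hf]
  | h0 => exact map_zero _
  | hadd x y hx hy => rw [map_add, hx, hy]
  | hsmul r x hx => rw [LinearMap.map_smulₛₗ, hx, hφ]

lemma mapSemilinear_comp (φ : R →+* R') (ψ : R' →+* R'') (χ : R →+* R'')
    (hχ : ∀ r, χ r = ψ (φ r)) (f : M →ₛₗ[φ] N) (g : N →ₛₗ[ψ] K) (h : M →ₛₗ[χ] K)
    (hh : ∀ m, h m = g (f m)) (n : ℕ) (x : ⋀[R]^n M) :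
    mapSemilinear χ h n x = mapSemilinear ψ g n (mapSemilinear φ f n x) := by
  induction x using induction_ιMulti with
  | h m => simp only [mapSemilinear_ιMulti, hh]
  | h0 => simp only [map_zero]
  | hadd x y hx hy => simp only [map_add, hx, hy]
  | hsmul r x hx => simp only [LinearMap.map_smulₛₗ, hx, hχ]

end exteriorPower

namespace AlgebraicGeometry.Scheme.Modules

variable {X : Scheme.{u}}

/-- The restriction map `Γ(M, V) → Γ(M, U)` for `U ⊆ V`, as a semilinear map. -/
def resₛₗ (M : X.Modules) {U V : X.Opens} (i : U ⟶ V) :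
    Γ(M, V) →ₛₗ[(X.presheaf.map i.op).hom] Γ(M, U) where
  toFun s := M.presheaf.map i.op s
  map_add' := map_add _
  map_smul' r s := M.map_smul i r s

/-- The presheaf `U ↦ ⋀ⁿ Γ(M, U)` (exterior power over `Γ(X, U)`). -/
def exteriorPowerAb (M : X.Modules) (n : ℕ) : X.Opensᵒᵖ ⥤ Ab.{u} where
  obj U := AddCommGrpCat.of (⋀[Γ(X, U.unop)]^n Γ(M, U.unop))
  map i := AddCommGrpCat.ofHom
    (exteriorPower.mapSemilinear (X.presheaf.map i.unop.op).hom (M.resₛₗ i.unop) n).toAddMonoidHom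
  map_id U := by
    refine AddCommGrpCat.hom_ext (AddMonoidHom.ext fun x ↦ ?_)
    exact exteriorPower.mapSemilinear_id (X.presheaf.map (𝟙 U.unop).op).hom
      (fun r ↦ by simp) (M.resₛₗ (𝟙 U.unop)) (fun m ↦ by simp [resₛₗ]) n x
  map_comp i j := by
    refine AddCommGrpCat.hom_ext (AddMonoidHom.ext fun x ↦ ?_)
    exact exteriorPower.mapSemilinear_comp (X.presheaf.map i.unop.op).hom
      (X.presheaf.map j.unop.op).hom (X.presheaf.map (i ≫ j).unop.op).hom
      (fun r ↦ by simp) (M.resₛₗ i.unop) (M.resₛₗ j.unop) (M.resₛₗ (i ≫ j).unop)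
      (fun m ↦ by simp [resₛₗ]) n x

/-- The presheaf of modules `U ↦ ⋀ⁿ Γ(M, U)`. -/
def exteriorPowerPresheaf (M : X.Modules) (n : ℕ) : X.PresheafOfModules :=
  letI (U : X.Opensᵒᵖ) : Module (X.ringCatSheaf.obj.obj U) ((M.exteriorPowerAb n).obj U) :=
    inferInstanceAs (Module Γ(X, U.unop) (⋀[Γ(X, U.unop)]^n Γ(M, U.unop)))
  PresheafOfModules.ofPresheaf (R := X.ringCatSheaf.obj) (M.exteriorPowerAb n)
    (fun _ _ i r m ↦
      (exteriorPower.mapSemilinear (X.presheaf.map i.unop.op).hom (M.resₛₗ i.unop) n).map_smulₛₗ r m)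

/-- The exterior power `⋀ⁿ M` of a sheaf of modules `M` on a scheme: the sheaf associated with the
presheaf `U ↦ ⋀ⁿ Γ(M, U)`. -/
def exteriorPower (M : X.Modules) (n : ℕ) : X.Modules :=
  (PresheafOfModules.sheafification (𝟙 X.ringCatSheaf.obj)).obj (M.exteriorPowerPresheaf n)

/-- The stalk `M_x` is a module over the local ring `𝒪_{X, x}`. -/
instance stalkModule (M : X.Modules) (x : X) :
    Module (X.presheaf.stalk x) (M.presheaf.stalk x) :=
  letI N : _root_.PresheafOfModules.{u} (X.presheaf ⋙ forget₂ CommRingCat RingCat) := M.val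
  letI : Module (X.presheaf.stalk x) (TopCat.Presheaf.stalk (C := Ab.{u}) (X := X.carrier) N.presheaf x) := inferInstance
  this

/-- `M` is locally free of rank `n`: every point has an open neighbourhood `U` with sections
`e₁, …, eₙ ∈ Γ(M, U)` whose restrictions form a basis of `Γ(M, V)` over `Γ(X, V)` for every open
`V ⊆ U`, i.e. which define an isomorphism `𝒪_Uⁿ ≅ M|_U`. -/
def IsLocallyFreeOfRank (M : X.Modules) (n : ℕ) : Prop :=
  ∀ x : X, ∃ U : X.Opens, x ∈ U ∧ ∃ e : Fin n → Γ(M, U), ∀ (V : X.Opens) (h : V ≤ U),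
    ∃ b : Module.Basis (Fin n) Γ(X, V) Γ(M, V), ∀ j, b j = M.presheaf.map (homOfLE h).op (e j)

/-! ### Jet ampleness -/

/-- The jet map `H⁰(X, L) → L_x / 𝔪_xᵐ L_x`. -/
def jetMap (L : X.Modules) (x : X) (m : ℕ) (s : Γ(L, (⊤ : X.Opens))) :
    L.presheaf.stalk x ⧸ ((IsLocalRing.maximalIdeal (X.presheaf.stalk x)) ^ m •
      (⊤ : Submodule (X.presheaf.stalk x) (L.presheaf.stalk x))) :=
  Submodule.Quotient.mk (L.presheaf.germ ⊤ x (Opens.mem_top x) s)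

/-- `L` is `k`-jet ample: for all distinct closed points `x₁, …, x_r` and positive integers
`k₁, …, k_r` with `∑ kᵢ = k + 1`, the map `H⁰(X, L) → ⨁ᵢ L_{xᵢ} / 𝔪_{xᵢ}^{kᵢ} L_{xᵢ}` is
surjective. -/
def IsJetAmple (L : X.Modules) (k : ℕ) : Prop :=
  ∀ (r : ℕ) (x : Fin r → X) (m : Fin r → ℕ), Function.Injective x →
    (∀ i, IsClosed ({x i} : Set X)) → (∀ i, 0 < m i) → ∑ i, m i = k + 1 →
      Function.Surjective (fun (s : Γ(L, (⊤ : X.Opens))) (i : Fin r) ↦ L.jetMap (x i) (m i) s)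

end AlgebraicGeometry.Scheme.Modules

/-! ### Projective space and very ample line bundles -/

namespace AlgebraicGeometry

variable (k : Type u) [Field k] (n : ℕ)

/-- Projective space `ℙⁿ = Proj k[x₀, …, xₙ]`. -/
def PSpace : Scheme.{u} := Proj (MvPolynomial.homogeneousSubmodule (Fin (n + 1)) k)

namespace PSpace

/-- The structure morphism `ℙⁿ ⟶ Spec k`. -/
def toSpec : PSpace k n ⟶ Spec (.of k) :=
  Proj.toSpecZero (MvPolynomial.homogeneousSubmodule (Fin (n + 1)) k) ≫
    Spec.map (CommRingCat.ofHom
      (algebraMap k (MvPolynomial.homogeneousSubmodule (Fin (n + 1)) k 0)))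

variable {n}

/-- The standard open set `D₊(xⱼ)`. -/
def chart (j : Fin (n + 1)) : (PSpace k n).Opens :=
  Proj.basicOpen (MvPolynomial.homogeneousSubmodule (Fin (n + 1)) k) (MvPolynomial.X j)

/-- The regular function `xᵢ / xⱼ` on `D₊(xⱼ)`. -/
def ratio (i j : Fin (n + 1)) : Γ(PSpace k n, chart k j) :=
  Proj.awayToSection (MvPolynomial.homogeneousSubmodule (Fin (n + 1)) k) (MvPolynomial.X j)
    (HomogeneousLocalization.Away.mk (MvPolynomial.homogeneousSubmodule (Fin (n + 1)) k)
      ((MvPolynomial.mem_homogeneousSubmodule 1 _).2 (MvPolynomial.isHomogeneous_X k j)) 1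
      (MvPolynomial.X i) (by
        rw [one_smul]
        exact (MvPolynomial.mem_homogeneousSubmodule 1 _).2 (MvPolynomial.isHomogeneous_X k i)))

end PSpace

variable {k n} {X : Scheme.{u}}

namespace Scheme.Modules

/-- The restriction of a global section of `L` to the open set `U`. -/
def globalRes (L : X.Modules) (U : X.Opens) (s : Γ(L, (⊤ : X.Opens))) : Γ(L, U) :=
  L.presheaf.map (homOfLE le_top).op s

/-- `φ : X ⟶ ℙⁿ` is the morphism given by the sections `s₀, …, sₙ` of `L`, in other words there is
an isomorphism `φ^* 𝒪(1) ≅ L` with `φ^* xᵢ ↦ sᵢ` for all `i`: on `φ⁻¹ D₊(xⱼ)` the section `sⱼ` is a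
basis of `L`, and `sᵢ = φ^*(xᵢ / xⱼ) sⱼ`. -/
structure IsMorphismOfSections (L : X.Modules) (s : Fin (n + 1) → Γ(L, (⊤ : X.Opens)))
    (φ : X ⟶ PSpace k n) : Prop where
  bijective_smul : ∀ (j : Fin (n + 1)) (V : X.Opens), V ≤ φ ⁻¹ᵁ PSpace.chart k j →
    Function.Bijective (fun a : Γ(X, V) ↦ a • L.globalRes V (s j))
  eq_smul : ∀ i j : Fin (n + 1),
    L.globalRes (φ ⁻¹ᵁ PSpace.chart k j) (s i) =
      φ.app (PSpace.chart k j) (PSpace.ratio k i j) • L.globalRes (φ ⁻¹ᵁ PSpace.chart k j) (s j)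

/-- An invertible sheaf `L` on a `k`-scheme `f : X ⟶ Spec k` is very ample (over `k`) if some
sections `s₀, …, sₙ ∈ H⁰(X, L)` define an immersion `X ⟶ ℙⁿ` over `k`; equivalently, if there is
an immersion `φ : X ⟶ ℙⁿ` over `k` with `φ^* 𝒪(1) ≅ L`. -/
def IsVeryAmpleLineBundle (f : X ⟶ Spec (.of k)) (L : X.Modules) : Prop :=
  L.IsLocallyFreeOfRank 1 ∧
    ∃ (n : ℕ) (s : Fin (n + 1) → Γ(L, (⊤ : X.Opens))) (φ : X ⟶ PSpace k n),
      L.IsMorphismOfSections s φ ∧ φ ≫ PSpace.toSpec k n = f ∧ IsImmersion φ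

/-! ### Projective bundles and very ample vector bundles -/

variable {S P : Scheme.{u}}

/-- `q : f^* E ⟶ L` is an invertible quotient of the pullback of `E` along `f : T ⟶ S`. -/
structure IsInvertibleQuotient (E : S.Modules) {T : Scheme.{u}} (f : T ⟶ S) (L : T.Modules)
    (q : (pullback f).obj E ⟶ L) : Prop where
  invertible : L.IsLocallyFreeOfRank 1
  epi : Epi q

/-- `π : P ⟶ S` together with `q : π^* E ⟶ L` is the projective bundle `ℙ(E)` with its tautological
quotient `π^* E ⟶ 𝒪(1)` (convention of Grothendieck: `ℙ(E) = Proj Sym E` and `π_* 𝒪(1) = E`): `q` is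
an invertible quotient, and it is universal, i.e. every invertible quotient `r : f^* E ⟶ M` for a
morphism `f : T ⟶ S` is isomorphic to the pullback of `q` along a unique `S`-morphism `g : T ⟶ P`. -/
structure IsProjectiveBundle (E : S.Modules) (π : P ⟶ S) (L : P.Modules)
    (q : (pullback π).obj E ⟶ L) : Prop where
  isInvertibleQuotient : E.IsInvertibleQuotient π L q
  existsUnique : ∀ {T : Scheme.{u}} (f : T ⟶ S) (M : T.Modules) (r : (pullback f).obj E ⟶ M),
    E.IsInvertibleQuotient f M r → ∃! g : T ⟶ P, ∃ (h : g ≫ π = f) (e : (pullback g).obj L ≅ M),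
      (pullback g).map q ≫ e.hom =
        (pullbackComp g π).hom.app E ≫ (pullbackCongr h).hom.app E ≫ r

/-- A vector bundle `E` on a `k`-scheme `f : S ⟶ Spec k` is very ample if the tautological line
bundle `𝒪(1)` on `ℙ(E)` is very ample. -/
def IsVeryAmple (f : S ⟶ Spec (.of k)) (E : S.Modules) : Prop :=
  ∃ (P : Scheme.{u}) (π : P ⟶ S) (L : P.Modules) (q : (pullback π).obj E ⟶ L),
    E.IsProjectiveBundle π L q ∧ L.IsVeryAmpleLineBundle (π ≫ f)

end Scheme.Modules

end AlgebraicGeometry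

end

/-!
Points of `ℙ(E)` with values in a local ring are pairs of a point `ρ` of `S` and homogeneous
coordinates `l`, at which a global section of `𝒪(1)`, that is, a section `σ` of `E` with
coordinates `c σ` in a local frame, takes the value `ρ (c σ) ⬝ᵥ l`. Very ampleness says that these
values never vanish simultaneously and determine the point, so sections of `E` separate the points
of `ℙ(E)` over local rings.

Over a field, linear algebra turns this into the surjectivity of `H⁰(S, E) → E(x) ⊕ E(y)` for
`x ≠ y`. Over `𝒪ₓ ⧸ J`, where `J` is generated by the functions `l₀ (c σ)₀ + l₁ (c σ)₁` for the
sections `σ` vanishing at `x`, the point `l` takes the same values as a point lying over the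
constant map, whence `J = 𝔪ₓ`: sections vanishing at `x` have arbitrary differentials in the
direction `l`.

Jets of `det E` are then realised by exterior products `σ ∧ τ`, one order of vanishing at a time.
Orders zero and one at `x` follow directly. For order two one has to span `𝔪ₓ² ⧸ 𝔪ₓ³` by
determinants of pairs of sections vanishing at `x`. A linear form on `𝔪ₓ² ⧸ 𝔪ₓ³` is a symmetric
bilinear form `B` on `𝔪ₓ ⧸ 𝔪ₓ²`. If it kills those determinants, the two coordinates `α` and `β`
of the sections vanishing at `x` satisfy `B (α w, β w') = B (α w', β w)`. All nonzero members of
the pencil `a α + b β` are surjective, so over an algebraically closed field there is a `w` with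
`α w ≠ 0` and `β w = c α w` modulo the kernel of `B`; then `α w` is orthogonal to the image of
`β - c α`, which forces `B = 0`.
-/

noncomputable section

namespace VeryAmpleBundle

/-! ### Local rings with residue field `k` -/

section LocalAlgebra

open IsLocalRing

section ResidueField

variable {k O : Type*} [Field k] [CommRing O] [Algebra k O] (v : O →ₐ[k] k)

/-- The part of a function vanishing at the point. -/
def vanishingPart : O →ₗ[k] O :=
  LinearMap.id - Algebra.linearMap k O ∘ₗ v.toLinearMap

lemma vanishingPart_apply (a : O) : vanishingPart v a = a - algebraMap k O (v a) := rfl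

/-- The bilinear form on `O` which a linear form on `O` defines through the multiplication of the
ideal of the point. -/
def cotangentForm (F : O →ₗ[k] k) : O →ₗ[k] O →ₗ[k] k :=
  ((LinearMap.mul k O).compl₁₂ (vanishingPart v) (vanishingPart v)).compr₂ F

lemma cotangentForm_apply (F : O →ₗ[k] k) (a b : O) :
    cotangentForm v F a b = F (vanishingPart v a * vanishingPart v b) := rfl

variable [IsLocalRing O]

lemma mem_maximalIdeal_iff {a : O} : a ∈ maximalIdeal O ↔ v a = 0 := by
  have hv : Function.Surjective (v : O →+* k) := fun a ↦ ⟨algebraMap k O a, v.commutes a⟩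
  rw [← eq_maximalIdeal (RingHom.ker_isMaximal_of_surjective (v : O →+* k) hv)]
  rfl

lemma vanishingPart_mem (a : O) : vanishingPart v a ∈ maximalIdeal O := by
  rw [mem_maximalIdeal_iff v, vanishingPart_apply, map_sub, v.commutes]
  exact sub_self _

lemma vanishingPart_eq_self {a : O} (ha : a ∈ maximalIdeal O) : vanishingPart v a = a := by
  rw [vanishingPart_apply, (mem_maximalIdeal_iff v).1 ha, map_zero, sub_zero]

include v in
lemma exists_mem_sub_mem_sq {N : Submodule k O} (hN : ∀ a ∈ N, a ∈ maximalIdeal O) {x : O}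
    (hx : x ∈ Ideal.span (N : Set O)) : ∃ y ∈ N, x - y ∈ maximalIdeal O ^ 2 := by
  induction hx using Submodule.span_induction with
  | mem x hx => exact ⟨x, hx, by simp⟩
  | zero => exact ⟨0, zero_mem _, by simp⟩
  | add x x' _ _ hx hx' =>
    obtain ⟨y, hy, hxy⟩ := hx
    obtain ⟨y', hy', hxy'⟩ := hx'
    exact ⟨y + y', add_mem hy hy', by simpa only [add_sub_add_comm] using add_mem hxy hxy'⟩
  | smul a x _ hx =>
    obtain ⟨y, hy, hxy⟩ := hx
    refine ⟨v a • y, N.smul_mem _ hy, ?_⟩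
    have hmul : vanishingPart v a * y ∈ maximalIdeal O ^ 2 :=
      pow_two (maximalIdeal O) ▸ Ideal.mul_mem_mul (vanishingPart_mem v a) (hN y hy)
    convert add_mem (Ideal.mul_mem_left _ a hxy) hmul using 1
    rw [vanishingPart_apply, smul_eq_mul, Algebra.smul_def (v a) y]
    ring

end ResidueField

section Pencil

variable {k V W : Type*} [Field k] [IsAlgClosed k] [AddCommGroup V] [Module k V]
  [AddCommGroup W] [Module k W]

-- Otherwise some `w` gives eigenvectors `α w`, `β w = c • α w` modulo the kernel of `B`, and then
-- `α w` is orthogonal to the image of `β - c • α`.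
lemma eq_zero_of_pencil {B : V →ₗ[k] V →ₗ[k] k} [FiniteDimensional k (V ⧸ B.ker)]
    (hB : ∀ p q, B p q = B q p) {α β : W →ₗ[k] V}
    (hαβ : ∀ w w', B (α w) (β w') = B (α w') (β w))
    (hsurj : ∀ a b : k, a ≠ 0 ∨ b ≠ 0 → ∀ p, ∃ w, B (a • α w + b • β w) = B p) : B = 0 := by
  by_contra hB0
  have : Nontrivial (V ⧸ B.ker) :=
    Submodule.Quotient.nontrivial_iff.2 (mt LinearMap.ker_eq_top.1 hB0)
  have hmk {p q : V} : B.ker.mkQ p = B.ker.mkQ q ↔ B p = B q := by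
    rw [Submodule.mkQ_apply, Submodule.mkQ_apply, Submodule.Quotient.eq, LinearMap.sub_mem_ker_iff]
  have hα : Function.Surjective (B.ker.mkQ ∘ₗ α) := by
    rintro ⟨p⟩
    obtain ⟨w, hw⟩ := hsurj 1 0 (Or.inl one_ne_zero) p
    exact ⟨w, hmk.2 (by simpa using hw)⟩
  obtain ⟨t, ht⟩ := (B.ker.mkQ ∘ₗ α).exists_rightInverse_of_surjective
    (LinearMap.range_eq_top.2 hα)
  obtain ⟨c, hc⟩ := Module.End.exists_eigenvalue (B.ker.mkQ ∘ₗ β ∘ₗ t)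
  obtain ⟨φ, hφ⟩ := hc.exists_hasEigenvector
  have hφα : B.ker.mkQ (α (t φ)) = φ := LinearMap.congr_fun ht φ
  have hφβ : B (β (t φ)) = c • B (α (t φ)) := by
    rw [← map_smul, ← hmk, map_smul, hφα]
    exact hφ.apply_eq_smul
  refine hφ.2 ?_
  rw [← hφα, Submodule.mkQ_apply, Submodule.Quotient.mk_eq_zero, LinearMap.mem_ker]
  ext p
  obtain ⟨w, hw⟩ := hsurj (-c) 1 (Or.inr one_ne_zero) p
  calc B (α (t φ)) p = B (-c • α w + (1 : k) • β w) (α (t φ)) := by rw [hB, hw]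
    _ = B (α (t φ)) (β w) - c * B (α (t φ)) (α w) := by
        rw [hB, map_add, map_smul, map_smul, one_smul, smul_eq_mul]
        ring
    _ = 0 := by
        rw [hαβ, hB, hφβ, LinearMap.smul_apply, smul_eq_mul, sub_self]

end Pencil

section Tangents

variable {k O W : Type*} [Field k] [CommRing O] [IsLocalRing O] [Algebra k O]
  [AddCommGroup W] [Module k W]

/-- For a rank two bundle over a base with local ring `O`, whose sections have the coordinates `c`
in a local frame: at every point `l` of the projective line over the closed point, the sections
vanishing at the closed point take all values in the cotangent space `𝔪 ⧸ 𝔪 ^ 2`. -/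
def SeparatesTangents (v : O →ₐ[k] k) (c : W →ₗ[k] Fin 2 → O) : Prop :=
  ∀ l : Fin 2 → k, l ≠ 0 → ∀ x ∈ maximalIdeal O, ∃ σ, (∀ j, v (c σ j) = 0) ∧
    x - ∑ j, l j • c σ j ∈ maximalIdeal O ^ 2

variable {v : O →ₐ[k] k} {c : W →ₗ[k] Fin 2 → O} {F : O →ₗ[k] k}

lemma cotangentForm_eq_zero (hF : ∀ a ∈ maximalIdeal O ^ 3, F a = 0) {a : O}
    (ha : a ∈ maximalIdeal O ^ 2) : cotangentForm v F a = 0 := by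
  ext b
  rw [cotangentForm_apply, vanishingPart_eq_self v (Ideal.pow_le_self two_ne_zero ha)]
  exact hF _ (pow_succ (maximalIdeal O) 2 ▸ Ideal.mul_mem_mul ha (vanishingPart_mem v b))

lemma cotangentForm_eq_of_sub_mem (hF : ∀ a ∈ maximalIdeal O ^ 3, F a = 0) {a b : O}
    (h : a - b ∈ maximalIdeal O ^ 2) : cotangentForm v F a = cotangentForm v F b := by
  rw [← sub_eq_zero, ← map_sub, cotangentForm_eq_zero hF h]

lemma cotangentForm_vanishingPart (a : O) :
    cotangentForm v F (vanishingPart v a) = cotangentForm v F a := by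
  ext b
  rw [cotangentForm_apply, vanishingPart_eq_self v (vanishingPart_mem v a), cotangentForm_apply]

lemma finiteDimensional_quotient_ker_cotangentForm (hm : (maximalIdeal O).FG)
    (hF : ∀ a ∈ maximalIdeal O ^ 3, F a = 0) :
    FiniteDimensional k (O ⧸ (cotangentForm v F).ker) := by
  obtain ⟨s, hs⟩ := hm
  let N : Submodule k O := Submodule.span k s
  have hN : ∀ a ∈ N, a ∈ maximalIdeal O := fun a ha ↦
    hs ▸ Submodule.span_le_restrictScalars k O (s : Set O) ha
  refine Module.Finite.of_surjective ((cotangentForm v F).ker.mkQ.domRestrict N) ?_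
  rintro ⟨a⟩
  have ha : vanishingPart v a ∈ Ideal.span (N : Set O) :=
    Ideal.span_mono Submodule.subset_span (hs.symm ▸ vanishingPart_mem v a)
  obtain ⟨y, hy, hay⟩ := exists_mem_sub_mem_sq v hN ha
  refine ⟨⟨y, hy⟩, (Submodule.Quotient.eq _).2 (LinearMap.sub_mem_ker_iff.2 ?_)⟩
  exact (cotangentForm_eq_of_sub_mem hF hay).symm.trans (cotangentForm_vanishingPart a)

lemma SeparatesTangents.sq_maximalIdeal_le [IsAlgClosed k] (hc : SeparatesTangents v c)
    (hm : (maximalIdeal O).FG) {G : Submodule k O} (hG : ∀ a ∈ maximalIdeal O ^ 3, a ∈ G)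
    (hdet : ∀ σ τ, (∀ j, v (c σ j) = 0) → (∀ j, v (c τ j) = 0) →
      (Matrix.of ![c σ, c τ]).det ∈ G) {x : O} (hx : x ∈ maximalIdeal O ^ 2) : x ∈ G := by
  by_contra hxG
  obtain ⟨F, hFx, hFG⟩ := Submodule.exists_le_ker_of_notMem hxG
  have hF : ∀ a ∈ maximalIdeal O ^ 3, F a = 0 := fun a ha ↦ hFG (hG a ha)
  let W₀ : Submodule k W := LinearMap.ker (LinearMap.pi fun j ↦ v.toLinearMap ∘ₗ .proj j ∘ₗ c)
  have hW₀ (w : W₀) (j : Fin 2) : v (c w j) = 0 := congrFun w.2 j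
  have hself (w : W₀) (j : Fin 2) : vanishingPart v (c w j) = c w j :=
    vanishingPart_eq_self v ((mem_maximalIdeal_iff v).2 (hW₀ w j))
  have := finiteDimensional_quotient_ker_cotangentForm (v := v) hm hF
  have hzero : cotangentForm v F = 0 := by
    refine eq_zero_of_pencil (α := .proj 0 ∘ₗ c ∘ₗ W₀.subtype) (β := .proj 1 ∘ₗ c ∘ₗ W₀.subtype)
      (fun a b ↦ ?_) (fun w w' ↦ ?_) fun a b hab p ↦ ?_
    · rw [cotangentForm_apply, cotangentForm_apply, mul_comm]
    · have hdet' : F ((Matrix.of ![c w, c w']).det) = 0 := hFG (hdet w w' (hW₀ w) (hW₀ w'))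
      rw [Matrix.det_fin_two, map_sub, sub_eq_zero] at hdet'
      simpa [cotangentForm_apply, hself, mul_comm] using hdet'
    · obtain ⟨σ, hσ, hpσ⟩ := hc ![a, b] (by simpa [← not_and_or] using hab) _
        (vanishingPart_mem v p)
      refine ⟨⟨σ, funext hσ⟩, ?_⟩
      rw [← cotangentForm_vanishingPart p, cotangentForm_eq_of_sub_mem hF hpσ]
      simp [Fin.sum_univ_two]
  have hFsq : ∀ y ∈ maximalIdeal O * maximalIdeal O, F y = 0 := fun y hy ↦ by
    refine Submodule.mul_induction_on hy (fun a ha b hb ↦ ?_)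
      fun a b ha hb ↦ by rw [map_add, ha, hb, add_zero]
    have := LinearMap.congr_fun₂ hzero a b
    rwa [cotangentForm_apply, vanishingPart_eq_self v ha, vanishingPart_eq_self v hb] at this
  exact hFx (hFsq x (pow_two (maximalIdeal O) ▸ hx))

end Tangents

end LocalAlgebra

/-! ### Separation of points with values in local algebras -/

section SeparatesPoints

open IsLocalRing Matrix

variable {k : Type u} {ι W : Type*} [Field k] {O : ι → Type u} [∀ i, CommRing (O i)]
  [∀ i, Algebra k (O i)] [AddCommGroup W] [Module k W]

/-- The sections of a rank two bundle, given by their coordinates `c i` in the local rings `O i` of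
some points of the base, generate the tautological line bundle of the projective bundle and
separate its points lying over the spectra of the `O i`. The point of the projective bundle with
homogeneous coordinates `l` over `ρ : O i →ₐ[k] R` evaluates a section `σ` to
`(ρ ∘ c i σ) ⬝ᵥ l`. Only local homomorphisms are compared, since the spectra of the local rings at
distinct points may meet away from the closed points. -/
structure SeparatesPoints (c : ∀ i, W →ₗ[k] Fin 2 → O i) : Prop where
  exists_isUnit (i : ι) {R : Type u} [CommRing R] [IsLocalRing R] [Algebra k R] (ρ : O i →ₐ[k] R)
    (l : Fin 2 → R) (hl : ∃ a, IsUnit (l a)) : ∃ σ, IsUnit ((ρ ∘ c i σ) ⬝ᵥ l)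
  sigma_eq {i j : ι} {R : Type u} [CommRing R] [IsLocalRing R] [Algebra k R] (ρ : O i →ₐ[k] R)
    (ρ' : O j →ₐ[k] R) [IsLocalHom ρ] [IsLocalHom ρ'] (l l' : Fin 2 → R)
    (hl : ∃ a, IsUnit (l a)) (hl' : ∃ a, IsUnit (l' a))
    (h : ∀ σ, (ρ ∘ c i σ) ⬝ᵥ l = (ρ' ∘ c j σ) ⬝ᵥ l') :
    (⟨i, ρ⟩ : Σ i, O i →ₐ[k] R) = ⟨j, ρ'⟩

lemma exists_ne_zero_forall_dotProduct_eq_zero {n : Type*} [Fintype n] {N : Submodule k (n → k)}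
    (hN : N ≠ ⊤) : ∃ l : n → k, l ≠ 0 ∧ ∀ a ∈ N, a ⬝ᵥ l = 0 := by
  classical
  obtain ⟨φ, hφ, hNφ⟩ := N.exists_le_ker_of_lt_top hN.lt_top
  obtain ⟨l, rfl⟩ := (dotProductEquiv k n).surjective φ
  exact ⟨l, fun hl ↦ hφ (by rw [hl, map_zero]), fun a ha ↦ (dotProduct_comm a l).trans (hNφ ha)⟩

lemma comp_dotProduct_algebraMap_comp {n A B : Type*} [Fintype n] [CommRing A] [Algebra k A]
    [CommRing B] [Algebra k B] (φ : A →ₐ[k] B) (a : n → A) (l : n → k) :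
    (φ ∘ a) ⬝ᵥ (algebraMap k B ∘ l) = φ (∑ s, l s • a s) := by
  rw [map_sum, dotProduct]
  refine Finset.sum_congr rfl fun s _ ↦ ?_
  rw [map_smul, Algebra.smul_def, mul_comm, Function.comp_apply, Function.comp_apply]

section LocalHom

variable {A : Type*} [CommRing A] [IsLocalRing A] [Algebra k A] (v : A →ₐ[k] k)

include v in
lemma isLocalHom_ofId_comp (B : Type*) [CommRing B] [Nontrivial B] [Algebra k B] :
    IsLocalHom ((Algebra.ofId k B).comp v) where
  map_nonunit a ha := by
    rw [← notMem_maximalIdeal, mem_maximalIdeal_iff v]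
    intro hva
    rw [AlgHom.comp_apply, hva, map_zero] at ha
    exact not_isUnit_zero ha

lemma isLocalHom_algHom : IsLocalHom v := by
  simpa [Algebra.ofId_self] using isLocalHom_ofId_comp v k

end LocalHom

namespace SeparatesPoints

variable {c : ∀ i, W →ₗ[k] Fin 2 → O i} (hc : SeparatesPoints c) (v : ∀ i, O i →ₐ[k] k)

include hc

lemma eq_zero_of_dotProduct_eq_zero (i : ι) {l : Fin 2 → k}
    (hl : ∀ σ, (v i ∘ c i σ) ⬝ᵥ l = 0) : l = 0 := by
  by_contra h
  obtain ⟨a, ha⟩ := Function.ne_iff.1 h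
  obtain ⟨σ, hσ⟩ := hc.exists_isUnit i (v i) l ⟨a, ha.isUnit⟩
  exact hσ.ne_zero (hl σ)

lemma exists_value_eq (i : ι) (a : Fin 2 → k) : ∃ σ, v i ∘ c i σ = a := by
  suffices hrange : ((v i).toLinearMap.compLeft (Fin 2) ∘ₗ c i).range = ⊤ from
    LinearMap.range_eq_top.1 hrange a
  by_contra hrange
  obtain ⟨l, hl, hσ⟩ := exists_ne_zero_forall_dotProduct_eq_zero hrange
  exact hl (hc.eq_zero_of_dotProduct_eq_zero v i fun σ ↦ hσ _ ⟨σ, rfl⟩)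

variable [∀ i, IsLocalRing (O i)]

lemma exists_value_eq_and_value_eq {i j : ι} (hij : i ≠ j) (a b : Fin 2 → k) :
    ∃ σ, v i ∘ c i σ = a ∧ v j ∘ c j σ = b := by
  let ev : W →ₗ[k] Fin 2 ⊕ Fin 2 → k := LinearMap.pi <| Sum.elim
    (fun s ↦ (v i).toLinearMap ∘ₗ .proj s ∘ₗ c i) fun s ↦ (v j).toLinearMap ∘ₗ .proj s ∘ₗ c j
  have hev (σ : W) : ev σ = Sum.elim (v i ∘ c i σ) (v j ∘ c j σ) := by ext (s | s) <;> rfl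
  suffices hrange : ev.range = ⊤ by
    obtain ⟨σ, hσ⟩ := LinearMap.range_eq_top.1 hrange (Sum.elim a b)
    exact ⟨σ, Sum.elim_eq_iff.1 (hev σ ▸ hσ)⟩
  by_contra hrange
  obtain ⟨l, hl, hσ⟩ := exists_ne_zero_forall_dotProduct_eq_zero hrange
  have hsum (σ : W) :
      (v i ∘ c i σ) ⬝ᵥ (l ∘ Sum.inl) + (v j ∘ c j σ) ⬝ᵥ (l ∘ Sum.inr) = 0 := by
    rw [← sumElim_dotProduct_sumElim, ← hev, Sum.elim_comp_inl_inr]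
    exact hσ _ ⟨σ, rfl⟩
  have hinl : l ∘ Sum.inl ≠ 0 := fun h ↦ by
    have hinr : l ∘ Sum.inr = 0 := hc.eq_zero_of_dotProduct_eq_zero v j fun σ ↦ by
      rw [← hsum σ, h, dotProduct_zero, zero_add]
    exact hl (by rw [← Sum.elim_comp_inl_inr l, h, hinr]; exact Sum.elim_zero_zero)
  have hinr : -(l ∘ Sum.inr) ≠ 0 := fun h ↦
    hinl <| hc.eq_zero_of_dotProduct_eq_zero v i fun σ ↦ by
      rw [← hsum σ, neg_eq_zero.1 h, dotProduct_zero, add_zero]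
  have := isLocalHom_algHom (v i)
  have := isLocalHom_algHom (v j)
  have := hc.sigma_eq (v i) (v j) (l ∘ Sum.inl) (-(l ∘ Sum.inr))
    ((Function.ne_iff.1 hinl).imp fun _ ↦ Ne.isUnit)
    ((Function.ne_iff.1 hinr).imp fun _ ↦ Ne.isUnit)
    fun σ ↦ by rw [dotProduct_neg, eq_neg_iff_add_eq_zero, hsum]
  exact hij (congrArg Sigma.fst this)

-- Modulo `J`, the point `l` over `O i` and a point factoring through `v i` take the same values,
-- so they agree.
lemma maximalIdeal_le (i : ι) {l : Fin 2 → k} (hl : l ≠ 0) {J : Ideal (O i)}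
    (hJ : J ≤ maximalIdeal (O i))
    (hlJ : ∀ σ, v i ∘ c i σ = 0 → ∑ s, l s • c i σ s ∈ J) : maximalIdeal (O i) ≤ J := by
  have : Nontrivial (O i ⧸ J) :=
    Ideal.Quotient.nontrivial_iff.2 (ne_top_of_le_ne_top (maximalIdeal.isMaximal _).ne_top hJ)
  have : IsLocalRing (O i ⧸ J) := .of_surjective' _ (Ideal.Quotient.mk_surjective (I := J))
  let val : W →ₗ[k] Fin 2 → k := (v i).toLinearMap.compLeft (Fin 2) ∘ₗ c i
  let ev : W →ₗ[k] O i := ∑ s, l s • LinearMap.proj s ∘ₗ c i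
  have hev (σ : W) : ev σ = ∑ s, l s • c i σ s := by simp [ev]
  choose τ hτ using fun s ↦ hc.exists_value_eq v i (Pi.single s 1)
  replace hτ (s : Fin 2) : val (τ s) = Pi.single s 1 := hτ s
  obtain ⟨s, hs⟩ := Function.ne_iff.1 hl
  have hτs : IsUnit (ev (τ s)) := by
    rw [← notMem_maximalIdeal, mem_maximalIdeal_iff (v i), hev, ← comp_dotProduct_algebraMap_comp]
    change ¬ val (τ s) ⬝ᵥ l = 0
    rwa [hτ, single_one_dotProduct]
  have hagree (σ : W) : (Ideal.Quotient.mkₐ k J ∘ c i σ) ⬝ᵥ (algebraMap k (O i ⧸ J) ∘ l) =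
      ((Algebra.ofId k (O i ⧸ J)).comp (v i) ∘ c i σ) ⬝ᵥ (Ideal.Quotient.mkₐ k J ∘ ev ∘ τ) := by
    have hmem : σ - ∑ s, val σ s • τ s ∈ val.ker := by
      rw [LinearMap.mem_ker, map_sub, map_sum, sub_eq_zero]
      ext t
      simp [hτ, Pi.single_apply]
    have hmk : Ideal.Quotient.mkₐ k J (ev σ) = Ideal.Quotient.mkₐ k J (ev (∑ s, val σ s • τ s)) :=
      Ideal.Quotient.eq.2 (by rw [← map_sub, hev]; exact hlJ _ hmem)
    rw [comp_dotProduct_algebraMap_comp, ← hev, hmk, map_sum, map_sum, dotProduct]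
    simp only [map_smul, Algebra.smul_def]
    rfl
  have : IsLocalHom (Ideal.Quotient.mkₐ k J) :=
    ⟨(IsLocalHom.of_surjective _ Ideal.Quotient.mk_surjective).map_nonunit⟩
  have := isLocalHom_ofId_comp (v i) (O i ⧸ J)
  have heq := eq_of_heq <| (Sigma.mk.inj <| hc.sigma_eq _ _ _ _
    ⟨s, hs.isUnit.map _⟩ ⟨s, hτs.map _⟩ hagree).2
  intro x hx
  rw [← Ideal.Quotient.eq_zero_iff_mem]
  refine (AlgHom.congr_fun heq x).trans ?_
  rw [AlgHom.comp_apply, (mem_maximalIdeal_iff (v i)).1 hx, map_zero]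

lemma separatesTangents (i : ι) : SeparatesTangents (v i) (c i) := by
  intro l hl
  let W₀ : Submodule k W := LinearMap.ker ((v i).toLinearMap.compLeft (Fin 2) ∘ₗ c i)
  let N : Submodule k (O i) := W₀.map (∑ s, l s • LinearMap.proj s ∘ₗ c i)
  have hN : ∀ a ∈ N, a ∈ maximalIdeal (O i) := by
    rintro _ ⟨σ, hσ, rfl⟩
    rw [mem_maximalIdeal_iff (v i)]
    have hσ' (s : Fin 2) : v i (c i σ s) = 0 := congrFun hσ s
    simp [hσ']
  intro x hx
  obtain ⟨_, ⟨σ, hσ, rfl⟩, hxσ⟩ := exists_mem_sub_mem_sq (v i) hN <|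
    hc.maximalIdeal_le v i hl (Ideal.span_le.2 hN)
      (fun σ hσ ↦ Ideal.subset_span ⟨σ, hσ, by simp⟩) hx
  exact ⟨σ, fun s ↦ congrFun hσ s, by simpa using hxσ⟩

end SeparatesPoints

end SeparatesPoints

/-! ### Jets of determinants of pairs of sections -/

section Jets

open IsLocalRing

lemma det_mem_pow_add {O : Type*} [CommRing O] {I : Ideal O} {a b : Fin 2 → O} {s t : ℕ}
    (ha : ∀ j, a j ∈ I ^ s) (hb : ∀ j, b j ∈ I ^ t) : (Matrix.of ![a, b]).det ∈ I ^ (s + t) := by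
  rw [Matrix.det_fin_two, pow_add]
  exact sub_mem (Ideal.mul_mem_mul (ha 0) (hb 1)) (Ideal.mul_mem_mul (ha 1) (hb 0))

section Combinatorics

variable {ι : Type*} [Fintype ι] [DecidableEq ι] {m : ι → ℕ}

lemma exists_le_add_single [Nonempty ι] {n : ℕ} (hm : ∑ i, m i ≤ n + 1) :
    ∃ (y : ι) (m' : ι → ℕ), ∑ i, m' i ≤ n ∧ m ≤ m' + Pi.single y 1 := by
  by_cases! h : ∃ y, m y ≠ 0
  · obtain ⟨y, hy⟩ := h
    have hlt : ∑ i, (m - Pi.single y 1 : ι → ℕ) i < ∑ i, m i :=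
      Finset.sum_lt_sum (fun i _ ↦ tsub_le_self) ⟨y, Finset.mem_univ y, by
        simpa using Nat.pos_of_ne_zero hy⟩
    exact ⟨y, m - Pi.single y 1, Nat.le_of_lt_succ (hlt.trans_le hm), le_tsub_add⟩
  · obtain rfl : m = 0 := funext h
    exact ⟨Classical.arbitrary ι, 0, by simp, zero_le⟩

lemma exists_le_single [Nonempty ι] (hm : ∑ i, m i ≤ 1) : ∃ y : ι, m ≤ Pi.single y 1 := by
  obtain ⟨y, m', hm', hy⟩ := exists_le_add_single (n := 0) hm
  obtain rfl : m' = 0 := funext fun i ↦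
    Finset.sum_eq_zero_iff.1 (Nat.le_zero.1 hm') i (Finset.mem_univ i)
  exact ⟨y, by simpa using hy⟩

lemma sum_update_zero_add (i : ι) : ∑ j, Function.update m i 0 j + m i = ∑ j, m j := by
  rw [Finset.sum_update_of_mem (Finset.mem_univ i), zero_add,
    Finset.sdiff_singleton_eq_erase, Finset.sum_erase_add _ _ (Finset.mem_univ i)]

end Combinatorics

variable {k : Type u} {ι W : Type*} [Field k] {O : ι → Type u} [∀ i, CommRing (O i)]
  [∀ i, IsLocalRing (O i)] [∀ i, Algebra k (O i)] [AddCommGroup W] [Module k W]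
  {c : ∀ i, W →ₗ[k] Fin 2 → O i} (hc : SeparatesPoints c) (v : ∀ i, O i →ₐ[k] k)
  {G : Submodule k (∀ i, O i)}
  (hG : ∀ σ τ, (fun i ↦ (Matrix.of ![c i σ, c i τ]).det) ∈ G)

namespace SeparatesPoints

include hc

lemma exists_value_eq_and_mem_pow [DecidableEq ι] (i y : ι) (a : Fin 2 → k) :
    ∃ σ, v i ∘ c i σ = a ∧
      ∀ j ≠ i, ∀ s, c j σ s ∈ maximalIdeal (O j) ^ (Pi.single y 1 : ι → ℕ) j := by
  obtain rfl | hy := eq_or_ne y i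
  · obtain ⟨σ, hσ⟩ := hc.exists_value_eq v y a
    exact ⟨σ, hσ, fun j hj s ↦ by simp [hj]⟩
  · obtain ⟨σ, hσ, hσy⟩ := hc.exists_value_eq_and_value_eq v hy.symm a 0
    refine ⟨σ, hσ, fun j _ s ↦ ?_⟩
    obtain rfl | hj := eq_or_ne j y
    · simpa [mem_maximalIdeal_iff (v j)] using congrFun hσy s
    · simp [hj]

include v hG

lemma exists_sub_mem_maximalIdeal [DecidableEq ι] (i y y' : ι) (x : O i) : ∃ g ∈ G,
    x - g i ∈ maximalIdeal (O i) ∧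
      ∀ j ≠ i, g j ∈ maximalIdeal (O j) ^ ((Pi.single y 1 + Pi.single y' 1 : ι → ℕ) j) := by
  obtain ⟨σ, hσ, hσy⟩ := hc.exists_value_eq_and_mem_pow v i y ![1, 0]
  obtain ⟨τ, hτ, hτy⟩ := hc.exists_value_eq_and_mem_pow v i y' ![0, 1]
  refine ⟨_, G.smul_mem (v i x) (hG σ τ), ?_, fun j hj ↦
    Submodule.smul_of_tower_mem _ _ (det_mem_pow_add (hσy j hj) (hτy j hj))⟩
  have hσ₀ : v i (c i σ 0) = 1 := congrFun hσ 0
  have hσ₁ : v i (c i σ 1) = 0 := congrFun hσ 1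
  have hτ₁ : v i (c i τ 1) = 1 := congrFun hτ 1
  rw [mem_maximalIdeal_iff (v i)]
  simp [Matrix.det_fin_two, hσ₀, hσ₁, hτ₁]

lemma exists_sub_mem_sq [DecidableEq ι] (i y : ι) {x : O i} (hx : x ∈ maximalIdeal (O i)) :
    ∃ g ∈ G, x - g i ∈ maximalIdeal (O i) ^ 2 ∧
      ∀ j ≠ i, g j ∈ maximalIdeal (O j) ^ (Pi.single y 1 : ι → ℕ) j := by
  obtain ⟨σ, hσ, hσy⟩ := hc.exists_value_eq_and_mem_pow v i y ![1, 0]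
  obtain ⟨τ, hτ, hxτ⟩ := hc.separatesTangents v i ![0, 1] (by simp) x hx
  refine ⟨_, hG σ τ, ?_, fun j hj ↦
    (det_mem_pow_add (t := 0) (hσy j hj) fun _ ↦ by simp)⟩
  replace hτ (s : Fin 2) : c i τ s ∈ maximalIdeal (O i) := (mem_maximalIdeal_iff (v i)).2 (hτ s)
  have hσ₀ : 1 - c i σ 0 ∈ maximalIdeal (O i) := by
    rw [mem_maximalIdeal_iff (v i), map_sub, map_one, sub_eq_zero]
    exact (congrFun hσ 0).symm
  have hσ₁ : c i σ 1 ∈ maximalIdeal (O i) := (mem_maximalIdeal_iff (v i)).2 (congrFun hσ 1)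
  have hx' : x - c i τ 1 ∈ maximalIdeal (O i) ^ 2 := by simpa using hxτ
  rw [pow_two] at hx' ⊢
  convert add_mem (add_mem hx' (Ideal.mul_mem_mul hσ₀ (hτ 1))) (Ideal.mul_mem_mul hσ₁ (hτ 0))
    using 1
  simp only [Matrix.det_fin_two, Matrix.of_apply, Matrix.cons_val_zero, Matrix.cons_val_one]
  ring

lemma exists_sub_mem_cube [IsAlgClosed k] {i : ι} (hm : (maximalIdeal (O i)).FG) {x : O i}
    (hx : x ∈ maximalIdeal (O i) ^ 2) : ∃ g ∈ G, x - g i ∈ maximalIdeal (O i) ^ 3 := by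
  have hmem := (hc.separatesTangents v i).sq_maximalIdeal_le hm
    (G := (maximalIdeal (O i) ^ 3).restrictScalars k ⊔ G.map (.proj i))
    (fun a ha ↦ Submodule.mem_sup_left ((Submodule.restrictScalars_mem _ _ _).2 ha))
    (fun σ τ _ _ ↦ Submodule.mem_sup_right ⟨_, hG σ τ, rfl⟩) hx
  obtain ⟨a, ha, _, ⟨g, hg, rfl⟩, rfl⟩ := Submodule.mem_sup.1 hmem
  exact ⟨g, hg, by simpa using ha⟩

variable [IsAlgClosed k] [Fintype ι] (hm : ∀ i, (maximalIdeal (O i)).FG) {m : ι → ℕ}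
  (hsum : ∑ i, m i ≤ 3)

include hm hsum

lemma exists_sub_mem_pow_succ {i : ι} {d : ℕ} (hd : d < m i) {x : O i}
    (hx : x ∈ maximalIdeal (O i) ^ d) : ∃ g ∈ G, x - g i ∈ maximalIdeal (O i) ^ (d + 1) ∧
      ∀ j ≠ i, g j ∈ maximalIdeal (O j) ^ m j := by
  classical
  have : Nonempty ι := ⟨i⟩
  have hothers := sum_update_zero_add (m := m) i
  have happrox {g : ∀ i, O i} {m' : ι → ℕ} (hm' : Function.update m i 0 ≤ m')
      (hg : ∀ j ≠ i, g j ∈ maximalIdeal (O j) ^ m' j) (j : ι) (hj : j ≠ i) :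
      g j ∈ maximalIdeal (O j) ^ m j :=
    Ideal.pow_le_pow_right (by simpa [hj] using hm' j) (hg j hj)
  match d with
  | 0 =>
    obtain ⟨y, m', hm', hy⟩ := exists_le_add_single (n := 1) (m := Function.update m i 0) (by omega)
    obtain ⟨y', hy'⟩ := exists_le_single hm'
    obtain ⟨g, hg, hxg, hgj⟩ := hc.exists_sub_mem_maximalIdeal v hG i y' y x
    exact ⟨g, hg, by simpa using hxg, happrox (hy.trans (by gcongr)) hgj⟩
  | 1 =>
    obtain ⟨y, hy⟩ := exists_le_single (m := Function.update m i 0) (by omega)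
    obtain ⟨g, hg, hxg, hgj⟩ := hc.exists_sub_mem_sq v hG i y (by simpa using hx)
    exact ⟨g, hg, hxg, happrox hy hgj⟩
  | 2 =>
    have hzero : Function.update m i 0 ≤ 0 := fun j ↦
      (Finset.single_le_sum (fun _ _ ↦ Nat.zero_le _) (Finset.mem_univ j)).trans (by omega)
    obtain ⟨g, hg, hxg⟩ := hc.exists_sub_mem_cube v hG (hm i) hx
    exact ⟨g, hg, hxg, happrox hzero (by simp)⟩
  | d + 3 => omega

lemma exists_sub_mem_pow (i : ι) (x : O i) : ∃ g ∈ G, x - g i ∈ maximalIdeal (O i) ^ m i ∧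
    ∀ j ≠ i, g j ∈ maximalIdeal (O j) ^ m j := by
  suffices h : ∀ d ≤ m i, ∃ g ∈ G, x - g i ∈ maximalIdeal (O i) ^ d ∧
    ∀ j ≠ i, g j ∈ maximalIdeal (O j) ^ m j from h _ le_rfl
  intro d hd
  induction d with
  | zero => exact ⟨0, zero_mem _, by simp, by simp⟩
  | succ d ih =>
    obtain ⟨g, hg, hxg, hgj⟩ := ih (Nat.le_of_succ_le hd)
    obtain ⟨g', hg', hxg', hgj'⟩ := hc.exists_sub_mem_pow_succ v hG hm hsum hd hxg
    exact ⟨g + g', add_mem hg hg', by rwa [Pi.add_apply, ← sub_sub],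
      fun j hj ↦ add_mem (hgj j hj) (hgj' j hj)⟩

theorem exists_forall_sub_mem_pow (x : ∀ i, O i) :
    ∃ g ∈ G, ∀ i, x i - g i ∈ maximalIdeal (O i) ^ m i := by
  classical
  choose g hg hxg hgj using fun i ↦ hc.exists_sub_mem_pow v hG hm hsum i (x i)
  refine ⟨∑ i, g i, sum_mem fun i _ ↦ hg i, fun i ↦ ?_⟩
  rw [Finset.sum_apply, ← Finset.add_sum_erase _ _ (Finset.mem_univ i), ← sub_sub]
  exact sub_mem (hxg i) (sum_mem fun j hj ↦ hgj j i (Finset.ne_of_mem_erase hj).symm)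

end SeparatesPoints

end Jets

open Scheme.Modules

/-! ### Linear functionals on sheaves of modules -/

section Functionals

variable {X Y Z : Scheme.{u}}

lemma presheaf_map_self {U : X.Opens} (i : U ⟶ U) (a : Γ(X, U)) : X.presheaf.map i.op a = a :=
  CategoryTheory.congr_fun (X.presheaf.map_id _) a

lemma presheaf_map_map {U V W : X.Opens} (i : U ⟶ V) (j : V ⟶ W) (a : Γ(X, W)) :
    X.presheaf.map i.op (X.presheaf.map j.op a) = X.presheaf.map (i ≫ j).op a := by
  rw [← ConcreteCategory.comp_apply, ← Functor.map_comp, op_comp]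

lemma modules_map_map (M : X.Modules) {U V W : X.Opens} (i : U ⟶ V) (j : V ⟶ W) (s : Γ(M, W)) :
    M.presheaf.map i.op (M.presheaf.map j.op s) = M.presheaf.map (i ≫ j).op s := by
  rw [← ConcreteCategory.comp_apply, ← Functor.map_comp, op_comp]

lemma presheaf_map_injective {U V : X.Opens} (i : U ⟶ V) (h : V ≤ U) :
    Function.Injective (X.presheaf.map i.op) := by
  obtain rfl : U = V := le_antisymm i.le h
  intro a b hab
  rwa [presheaf_map_self, presheaf_map_self] at hab

lemma preimage_le_preimage_inf {f : X ⟶ Y} {U : Y.Opens} (hf : ⊤ ≤ f ⁻¹ᵁ U) (V : Y.Opens) :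
    f ⁻¹ᵁ V ≤ f ⁻¹ᵁ (V ⊓ U) :=
  le_inf le_rfl (le_top.trans hf)

lemma appLE_top_top (f : X ⟶ Y) (h) : f.appLE ⊤ ⊤ h = f.appTop :=
  f.app_eq_appLE.symm

/-- The structure sheaf, as a sheaf of modules over itself. -/
abbrev structureModule (X : Scheme.{u}) : X.Modules := SheafOfModules.unit X.ringCatSheaf

lemma isLocallyFreeOfRank_structureModule (X : Scheme.{u}) :
    (structureModule X).IsLocallyFreeOfRank 1 := fun _ ↦
  ⟨⊤, trivial, fun _ ↦ (1 : Γ(X, ⊤)), fun V h ↦ ⟨Module.Basis.singleton (Fin 1) Γ(X, V), fun j ↦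
    (Module.Basis.singleton_apply (Fin 1) Γ(X, V) j).trans
      (map_one (X.presheaf.map (homOfLE h).op).hom).symm⟩⟩

/-- The linear functional `g^* L ⟶ 𝒪_X` adjoint to `α : L ⟶ g_* 𝒪_X`. -/
abbrev functional {g : X ⟶ Y} {L : Y.Modules}
    (α : L ⟶ (pushforward g).obj (structureModule X)) : (pullback g).obj L ⟶ structureModule X :=
  ((pullbackPushforwardAdjunction g).homEquiv _ _).symm α

variable {g : X ⟶ Y} {L : Y.Modules} (α : L ⟶ (pushforward g).obj (structureModule X))

/-- The map on sections over `V` of a morphism `L ⟶ g_* 𝒪_X`. -/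
def evalOn (V : Y.Opens) : Γ(L, V) →+ Γ(X, g ⁻¹ᵁ V) :=
  (α.app V).hom

lemma evalOn_smul (V : Y.Opens) (a : Γ(Y, V)) (s : Γ(L, V)) :
    evalOn α V (a • s) = g.app V a * evalOn α V s :=
  α.app_smul a s

lemma evalOn_res {U V : Y.Opens} (i : U ⟶ V) (s : Γ(L, V)) :
    evalOn α U (L.presheaf.map i.op s) =
      X.presheaf.map ((Opens.map g.base).map i).op (evalOn α V s) :=
  CategoryTheory.congr_fun (α.mapPresheaf.naturality i.op) s

/-- The map on sections of a morphism `L ⟶ g_* 𝒪_X` over an open set `V` containing the image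
of `g`, with values in the global functions. -/
def evalTop (V : Y.Opens) (hV : ⊤ ≤ g ⁻¹ᵁ V) : Γ(L, V) →+ Γ(X, ⊤) :=
  (X.presheaf.map (homOfLE hV).op).hom.toAddMonoidHom.comp (evalOn α V)

lemma evalTop_apply (V : Y.Opens) (hV : ⊤ ≤ g ⁻¹ᵁ V) (s : Γ(L, V)) :
    evalTop α V hV s = X.presheaf.map (homOfLE hV).op (evalOn α V s) := rfl

lemma evalTop_smul (V : Y.Opens) (hV : ⊤ ≤ g ⁻¹ᵁ V) (a : Γ(Y, V)) (s : Γ(L, V)) :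
    evalTop α V hV (a • s) = g.appLE V ⊤ hV a * evalTop α V hV s := by
  rw [evalTop_apply, evalOn_smul, map_mul]
  rfl

lemma evalTop_res {U V : Y.Opens} (i : U ⟶ V) (hU : ⊤ ≤ g ⁻¹ᵁ U) (hV : ⊤ ≤ g ⁻¹ᵁ V)
    (s : Γ(L, V)) : evalTop α U hU (L.presheaf.map i.op s) = evalTop α V hV s := by
  rw [evalTop_apply, evalOn_res, evalTop_apply, presheaf_map_map]
  rfl

/-- A morphism `L ⟶ N` of sheaves of modules from compatible linear maps on sections. -/
def homOfSections {L N : Y.Modules} (F : ∀ V : Y.Opens, Γ(L, V) →+ Γ(N, V))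
    (hsmul : ∀ V (a : Γ(Y, V)) s, F V (a • s) = a • F V s)
    (hres : ∀ (U V : Y.Opens) (i : U ⟶ V) s,
      F U (L.presheaf.map i.op s) = N.presheaf.map i.op (F V s)) :
    L ⟶ N :=
  (fullyFaithfulToPresheafOfModules (X := Y)).preimage
    (PresheafOfModules.homMk
      { app := fun V ↦ AddCommGrpCat.ofHom (F V.unop)
        naturality := fun U V i ↦ by
          ext s
          exact hres V.unop U.unop i.unop s }
      (fun V a s ↦ hsmul V.unop a s))

lemma epi_functional_of_isUnit {U : Y.Opens} (hU : ⊤ ≤ g ⁻¹ᵁ U) (s : Γ(L, U))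
    (hs : IsUnit (evalTop α U hU s)) : Epi (functional α) := by
  obtain ⟨v, hv⟩ := hs.exists_left_inv
  refine ⟨fun {N} h h' hh ↦ ?_⟩
  have hα : α ≫ (pushforward g).map h = α ≫ (pushforward g).map h' := by
    have := congrArg ((pullbackPushforwardAdjunction g).homEquiv _ _) hh
    rwa [Adjunction.homEquiv_naturality_right, Adjunction.homEquiv_naturality_right,
      Equiv.apply_symm_apply] at this
  have hvalue : h.app (g ⁻¹ᵁ U) (evalOn α U s) = h'.app (g ⁻¹ᵁ U) (evalOn α U s) :=
    CategoryTheory.congr_fun (congrArg (fun γ ↦ γ.app U) hα) s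
  ext W (a : Γ(X, W))
  let iW : W ⟶ g ⁻¹ᵁ U := homOfLE (le_top.trans hU)
  let c : Γ(X, W) := a * X.presheaf.map (homOfLE le_top).op v
  have ha : a = c * X.presheaf.map iW.op (evalOn α U s) := by
    have hvW := congrArg (X.presheaf.map (homOfLE (le_top : W ≤ ⊤)).op) hv
    rw [map_mul, map_one, evalTop_apply, presheaf_map_map] at hvW
    exact (mul_one a).symm.trans ((congrArg _ hvW.symm).trans (mul_assoc _ _ _).symm)
  have happ (h : structureModule X ⟶ N) :
      h.app W a = c • N.presheaf.map iW.op (h.app (g ⁻¹ᵁ U) (evalOn α U s)) :=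
    (congrArg (h.app W) ha).trans ((h.app_smul (M := structureModule X) c _).trans
      (congrArg _ (CategoryTheory.congr_fun (h.mapPresheaf.naturality iW.op) (evalOn α U s))))
  exact (happ h).trans ((congrArg _ (congrArg _ hvalue)).trans (happ h').symm)

lemma homEquiv_pullbackComp (f : X ⟶ Y) (g : Y ⟶ Z) {E : Z.Modules} {N : X.Modules}
    (r : (pullback (f ≫ g)).obj E ⟶ N) :
    (pullbackPushforwardAdjunction (f ≫ g)).homEquiv _ _ r =
      (pullbackPushforwardAdjunction g).homEquiv _ _
        ((pullbackPushforwardAdjunction f).homEquiv _ _ ((pullbackComp f g).hom.app E ≫ r)) ≫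
        (pushforwardComp f g).hom.app N := by
  have h := unit_conjugateEquiv ((pullbackPushforwardAdjunction g).comp
    (pullbackPushforwardAdjunction f)) (pullbackPushforwardAdjunction (f ≫ g))
    (pullbackComp f g).inv E
  rw [conjugateEquiv_pullbackComp_inv] at h
  have hr : r = (pullbackComp f g).inv.app E ≫ ((pullbackComp f g).hom.app E ≫ r) := by simp
  conv_lhs => rw [hr]
  rw [Adjunction.homEquiv_unit, Functor.map_comp, ← Category.assoc, ← h]
  simp only [Category.assoc]
  rw [← NatTrans.naturality]
  simp only [Adjunction.homEquiv_unit, Adjunction.comp_unit_app, Functor.comp_map,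
    Functor.map_comp, Category.assoc]

end Functionals

section StructureSheaf

variable {X Y : Scheme.{u}}

/-- Multiplication by a function, as an endomorphism of the structure sheaf. -/
def mulHom (u : Γ(X, ⊤)) : structureModule X ⟶ structureModule X :=
  homOfSections
    (fun V ↦ AddMonoidHom.mulLeft (X.presheaf.map (homOfLE le_top).op u : Γ(X, V)))
    (fun V (a : Γ(X, V)) (s : Γ(X, V)) ↦ mul_left_comm _ a s)
    (fun U V i (s : Γ(X, V)) ↦ by
      change _ * X.presheaf.map i.op s = X.presheaf.map i.op (_ * s)
      rw [map_mul, presheaf_map_map]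
      rfl)

lemma mulHom_comp_mulHom_of_mul_eq_one {u v : Γ(X, ⊤)} (h : u * v = 1) :
    mulHom u ≫ mulHom v = 𝟙 _ := by
  ext U (s : Γ(X, U))
  change X.presheaf.map _ v * (X.presheaf.map _ u * s) = s
  rw [← mul_assoc, ← map_mul, mul_comm v u, h, map_one, one_mul]

/-- Multiplication by a unit, as an automorphism of the structure sheaf. -/
def mulUnit (u : Γ(X, ⊤)ˣ) : structureModule X ≅ structureModule X where
  hom := mulHom u
  inv := mulHom ↑u⁻¹
  hom_inv_id := mulHom_comp_mulHom_of_mul_eq_one (by simp)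
  inv_hom_id := mulHom_comp_mulHom_of_mul_eq_one (by simp)

/-- The structure morphism `𝒪_Y ⟶ h_* 𝒪_X` of a morphism of schemes. -/
def unitToPushforward (h : X ⟶ Y) : structureModule Y ⟶ (pushforward h).obj (structureModule X) :=
  SheafOfModules.unitToPushforwardObjUnit h.toRingCatSheafHom

instance final_opensMap (f : X ⟶ Y) : (Opens.map f.base).Final where
  out U := isConnected_of_isTerminal
    (x := StructuredArrow.mk (Y := (⊤ : Y.Opens)) (homOfLE le_top)) _
    (Limits.IsTerminal.ofUniqueHom
      (fun V ↦ StructuredArrow.homMk (homOfLE le_top) (Subsingleton.elim _ _))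
      (fun V m ↦ by ext1; exact Subsingleton.elim _ _))

instance isIso_functional_unitToPushforward (h : X ⟶ Y) :
    IsIso (functional (unitToPushforward h)) := by
  have : (SheafOfModules.pushforward.{u} h.toRingCatSheafHom).IsRightAdjoint :=
    inferInstanceAs (pushforward h).IsRightAdjoint
  exact SheafOfModules.instIsIsoPullbackObjUnitToUnitOfFinal (F := Opens.map h.base)
    h.toRingCatSheafHom

end StructureSheaf

/-! ### Trivialized points -/

/-- A `T`-valued point of `Y` together with a trivialization `hom^* L ≅ 𝒪_T`, encoded by its
adjoint `L ⟶ hom_* 𝒪_T`. For `L = 𝒪(1)` on a projective space these are the points with a choice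
of homogeneous coordinates. -/
structure TrivializedPoint {Y : Scheme.{u}} (L : Y.Modules) (T : Scheme.{u}) where
  /-- The underlying point. -/
  hom : T ⟶ Y
  /-- The adjoint of the trivialization. -/
  map : L ⟶ (pushforward hom).obj (structureModule T)
  isIso : IsIso (functional map)

attribute [instance] TrivializedPoint.isIso

namespace TrivializedPoint

variable {T T' Y : Scheme.{u}} {L : Y.Modules} (p : TrivializedPoint L T)

/-- The value of a section of `L` at a trivialized point. -/
def eval (V : Y.Opens) (hV : ⊤ ≤ p.hom ⁻¹ᵁ V) : Γ(L, V) →+ Γ(T, ⊤) := evalTop p.map V hV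

/-- The value of a global section of `L` at a trivialized point. -/
def evalGlobal : Γ(L, ⊤) →+ Γ(T, ⊤) := p.eval ⊤ le_rfl

/-- The composite of a trivialized point with a morphism `T' ⟶ T`. -/
def comp (h : T' ⟶ T) : TrivializedPoint L T' where
  hom := h ≫ p.hom
  map := p.map ≫ (pushforward p.hom).map (unitToPushforward h) ≫
    (pushforwardComp h p.hom).hom.app _
  isIso := by
    let r := (pullbackComp h p.hom).inv.app L ≫ (pullback h).map (functional p.map) ≫
      functional (unitToPushforward h)
    have hr : (pullbackPushforwardAdjunction (h ≫ p.hom)).homEquiv _ _ r = p.map ≫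
        (pushforward p.hom).map (unitToPushforward h) ≫ (pushforwardComp h p.hom).hom.app _ := by
      rw [homEquiv_pullbackComp]
      simp only [r, Iso.hom_inv_id_app_assoc]
      rw [Adjunction.homEquiv_naturality_left, Equiv.apply_symm_apply,
        Adjunction.homEquiv_naturality_right, Equiv.apply_symm_apply, Category.assoc]
    rw [functional, ← hr, Equiv.symm_apply_apply]
    infer_instance

lemma eval_comp (h : T' ⟶ T) (V : Y.Opens) (hV : ⊤ ≤ p.hom ⁻¹ᵁ V)
    (hV' : ⊤ ≤ (p.comp h).hom ⁻¹ᵁ V) (s : Γ(L, V)) :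
    (p.comp h).eval V hV' s = h.appTop (p.eval V hV s) := by
  have := CategoryTheory.congr_fun (h.naturality (homOfLE hV).op) (evalOn p.map V s)
  simp only [ConcreteCategory.comp_apply] at this
  exact this.symm

lemma evalGlobal_comp (h : T' ⟶ T) (s : Γ(L, ⊤)) :
    (p.comp h).evalGlobal s = h.appTop (p.evalGlobal s) :=
  p.eval_comp h ⊤ le_rfl le_rfl s

/-- The trivialized point with the same underlying point and the trivialization multiplied by a
unit. -/
def scale (u : Γ(T, ⊤)ˣ) : TrivializedPoint L T where
  hom := p.hom
  map := p.map ≫ (pushforward p.hom).map (mulUnit u).hom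
  isIso := by
    rw [functional, Adjunction.homEquiv_naturality_right_symm]
    infer_instance

lemma eval_scale (u : Γ(T, ⊤)ˣ) (V : Y.Opens) (hV : ⊤ ≤ p.hom ⁻¹ᵁ V) (s : Γ(L, V)) :
    (p.scale u).eval V hV s = u * p.eval V hV s := by
  let i : ⊤ ⟶ p.hom ⁻¹ᵁ V := homOfLE hV
  change T.presheaf.map i.op (T.presheaf.map (homOfLE le_top).op u * evalOn p.map V s) = _
  rw [map_mul, presheaf_map_map, presheaf_map_self]
  rfl

lemma evalGlobal_scale (u : Γ(T, ⊤)ˣ) (s : Γ(L, ⊤)) :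
    (p.scale u).evalGlobal s = u * p.evalGlobal s :=
  p.eval_scale u ⊤ le_rfl s

end TrivializedPoint

/-! ### Frames -/

/-- The sections `e₁, …, eₙ` of `E` over `U` form a basis over every open subset of `U`. -/
def IsFrame {Y : Scheme.{u}} (E : Y.Modules) {n : ℕ} (U : Y.Opens) (e : Fin n → Γ(E, U)) : Prop :=
  ∀ (V : Y.Opens) (h : V ≤ U), ∃ b : Module.Basis (Fin n) Γ(Y, V) Γ(E, V),
    ∀ j, b j = E.presheaf.map (homOfLE h).op (e j)

namespace IsFrame

variable {X Y : Scheme.{u}} {E : Y.Modules} {n : ℕ} {U : Y.Opens} {e : Fin n → Γ(E, U)}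
  (he : IsFrame E U e)

include he in
lemma mono {U' : Y.Opens} (h : U' ≤ U) :
    IsFrame E U' (fun i ↦ E.presheaf.map (homOfLE h).op (e i)) := by
  intro V hV
  obtain ⟨b, hb⟩ := he V (hV.trans h)
  refine ⟨b, fun j ↦ (hb j).trans ?_⟩
  rw [modules_map_map]
  rfl

/-- The coordinates, with respect to a frame over `U`, of the sections over an open `V ≤ U`. -/
def coord {V : Y.Opens} (h : V ≤ U) : Γ(E, V) ≃ₗ[Γ(Y, V)] (Fin n → Γ(Y, V)) :=
  (he V h).choose.equivFun

lemma sum_coord {V : Y.Opens} (h : V ≤ U) (s : Γ(E, V)) :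
    ∑ i, he.coord h s i • E.presheaf.map (homOfLE h).op (e i) = s := by
  refine Eq.trans (Finset.sum_congr rfl fun i _ ↦ ?_) ((he V h).choose.sum_equivFun s)
  rw [(he V h).choose_spec]
  rfl

lemma coord_sum {V : Y.Opens} (h : V ≤ U) (a : Fin n → Γ(Y, V)) :
    he.coord h (∑ i, a i • E.presheaf.map (homOfLE h).op (e i)) = a := by
  refine Eq.trans (congrArg _ ?_) ((he V h).choose.equivFun.apply_symm_apply a)
  rw [Module.Basis.equivFun_symm_apply]
  exact Finset.sum_congr rfl fun i _ ↦ by rw [(he V h).choose_spec]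

lemma coord_res {V V' : Y.Opens} (h : V ≤ U) (i : V' ⟶ V) (s : Γ(E, V)) (j : Fin n) :
    he.coord (i.le.trans h) (E.presheaf.map i.op s) j = Y.presheaf.map i.op (he.coord h s j) := by
  have hs : E.presheaf.map i.op s = ∑ j, Y.presheaf.map i.op (he.coord h s j) •
      E.presheaf.map (homOfLE (i.le.trans h)).op (e j) := by
    conv_lhs => rw [← he.sum_coord h s, map_sum]
    refine Finset.sum_congr rfl fun j _ ↦ ?_
    rw [map_smul, modules_map_map]
    rfl
  rw [hs, coord_sum]

lemma coord_frame {V : Y.Opens} (h : V ≤ U) (j : Fin n) :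
    he.coord h (E.presheaf.map (homOfLE h).op (e j)) = Pi.single j 1 := by
  conv_rhs => rw [← he.coord_sum h (Pi.single j 1)]
  congr 1
  simp [Pi.single_apply]

include he in
lemma hom_ext {f : X ⟶ Y} {α β : E ⟶ (pushforward f).obj (structureModule X)} (hf : ⊤ ≤ f ⁻¹ᵁ U)
    (h : ∀ i, evalTop α U hf (e i) = evalTop β U hf (e i)) : α = β := by
  have heval (i : Fin n) : evalOn α U (e i) = evalOn β U (e i) :=
    presheaf_map_injective (homOfLE hf) le_top (h i)
  ext V (s : Γ(E, V))
  change evalOn α V s = evalOn β V s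
  let i : V ⊓ U ⟶ V := homOfLE inf_le_left
  refine presheaf_map_injective ((Opens.map f.base).map i)
    (preimage_le_preimage_inf hf V) ?_
  rw [← evalOn_res, ← evalOn_res, ← he.sum_coord inf_le_right (E.presheaf.map i.op s)]
  simp only [map_sum, evalOn_smul, evalOn_res, heval]

include he in
lemma functional_congr {f f' : X ⟶ Y} (h : f' = f)
    {α : E ⟶ (pushforward f).obj (structureModule X)}
    {β : E ⟶ (pushforward f').obj (structureModule X)} (hf : ⊤ ≤ f ⁻¹ᵁ U) (hf' : ⊤ ≤ f' ⁻¹ᵁ U)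
    (hαβ : ∀ i, evalTop α U hf (e i) = evalTop β U hf' (e i)) :
    functional β = (pullbackCongr h).hom.app E ≫ functional α := by
  subst h
  rw [he.hom_ext hf hαβ]
  simp [pullbackCongr]

section Hom

variable (f : X ⟶ Y) (hf : ⊤ ≤ f ⁻¹ᵁ U) (l : Fin n → Γ(X, ⊤))

/-- The map on sections over `V` of the morphism `IsFrame.hom`. A section over `V` is expanded in
the frame over `V ⊓ U`, which is harmless since `V` and `V ⊓ U` have the same preimage in `X`. -/
def homApp (V : Y.Opens) : Γ(E, V) →+ Γ(X, f ⁻¹ᵁ V) where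
  toFun s := ∑ i, f.appLE (V ⊓ U) (f ⁻¹ᵁ V) (preimage_le_preimage_inf hf V)
    (he.coord inf_le_right (E.presheaf.map (homOfLE inf_le_left).op s) i) *
      X.presheaf.map (homOfLE le_top).op (l i)
  map_zero' := by simp only [map_zero, Pi.zero_apply, zero_mul, Finset.sum_const_zero]
  map_add' s t := by simp only [map_add, Pi.add_apply, add_mul, Finset.sum_add_distrib]

lemma homApp_apply (V : Y.Opens) (s : Γ(E, V)) :
    he.homApp f hf l V s = ∑ i, f.appLE (V ⊓ U) (f ⁻¹ᵁ V) (preimage_le_preimage_inf hf V)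
      (he.coord inf_le_right (E.presheaf.map (homOfLE inf_le_left).op s) i) *
        X.presheaf.map (homOfLE le_top).op (l i) := rfl

lemma homApp_smul (V : Y.Opens) (a : Γ(Y, V)) (s : Γ(E, V)) :
    he.homApp f hf l V (a • s) = f.app V a * he.homApp f hf l V s := by
  rw [homApp_apply, homApp_apply, Finset.mul_sum]
  refine Finset.sum_congr rfl fun i _ ↦ ?_
  rw [map_smul, LinearEquiv.map_smul, Pi.smul_apply, smul_eq_mul, map_mul, mul_assoc,
    ← ConcreteCategory.comp_apply, Scheme.Hom.map_appLE, ← Scheme.Hom.app_eq_appLE]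

lemma homApp_res {V V' : Y.Opens} (i : V' ⟶ V) (s : Γ(E, V)) :
    he.homApp f hf l V' (E.presheaf.map i.op s) =
      X.presheaf.map ((Opens.map f.base).map i).op (he.homApp f hf l V s) := by
  rw [homApp_apply, homApp_apply, map_sum]
  refine Finset.sum_congr rfl fun j _ ↦ ?_
  have hs : E.presheaf.map (homOfLE inf_le_left).op (E.presheaf.map i.op s) =
      E.presheaf.map (homOfLE (inf_le_inf_right U i.le)).op
        (E.presheaf.map (homOfLE inf_le_left).op s) := by
    rw [modules_map_map, modules_map_map]
    rfl
  rw [hs, he.coord_res inf_le_right, map_mul, presheaf_map_map]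
  simp only [← ConcreteCategory.comp_apply]
  rw [Scheme.Hom.map_appLE, Scheme.Hom.appLE_map]
  rfl

/-- The morphism `E ⟶ f_* 𝒪_X` with values `l₁, …, lₙ` on a frame over an open set containing the
image of `f`. -/
def hom : E ⟶ (pushforward f).obj (structureModule X) :=
  homOfSections (he.homApp f hf l) (he.homApp_smul f hf l) fun _ _ ↦ he.homApp_res f hf l

lemma evalTop_hom_self (i : Fin n) : evalTop (he.hom f hf l) U hf (e i) = l i := by
  change X.presheaf.map (homOfLE hf).op (he.homApp f hf l U (e i)) = l i
  rw [homApp_apply, he.coord_frame (V := U ⊓ U) inf_le_right i, Finset.sum_eq_single i]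
  · rw [Pi.single_eq_same, map_one, one_mul, presheaf_map_map, presheaf_map_self]
  · intro j _ hj
    rw [Pi.single_eq_of_ne hj, map_zero, zero_mul]
  · simp

end Hom

end IsFrame

/-! ### Points of a projective bundle -/

section ProjectiveBundle

variable {S P T T' : Scheme.{u}} {E : S.Modules} {π : P ⟶ S} {L : P.Modules}
  (q : (pullback π).obj E ⟶ L)

namespace TrivializedPoint

variable (p : TrivializedPoint L T)

/-- The quotient `E_T ⟶ 𝒪_T` classified by a trivialized point of `ℙ(E)`, as a morphism from `E`
to the direct image of `𝒪_T`. -/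
def quotientMap : E ⟶ (pushforward (p.hom ≫ π)).obj (structureModule T) :=
  (pullbackPushforwardAdjunction π).homEquiv _ _ q ≫ (pushforward π).map p.map ≫
    (pushforwardComp p.hom π).hom.app _

/-- The value at a section of `E` of the quotient `E_T ⟶ 𝒪_T` classified by a trivialized point
of `ℙ(E)`. -/
def value (U : S.Opens) (hU : ⊤ ≤ (p.hom ≫ π) ⁻¹ᵁ U) : Γ(E, U) →+ Γ(T, ⊤) :=
  evalTop (p.quotientMap q) U hU

lemma value_smul {U : S.Opens} (hU : ⊤ ≤ (p.hom ≫ π) ⁻¹ᵁ U) (a : Γ(S, U)) (σ : Γ(E, U)) :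
    p.value q U hU (a • σ) = (p.hom ≫ π).appLE U ⊤ hU a * p.value q U hU σ :=
  evalTop_smul _ _ _ _ _

lemma value_res {U V : S.Opens} (i : V ⟶ U) (hV : ⊤ ≤ (p.hom ≫ π) ⁻¹ᵁ V)
    (hU : ⊤ ≤ (p.hom ≫ π) ⁻¹ᵁ U) (σ : Γ(E, U)) :
    p.value q V hV (E.presheaf.map i.op σ) = p.value q U hU σ :=
  evalTop_res _ i _ _ _

lemma value_comp (h : T' ⟶ T) {U : S.Opens} (hU : ⊤ ≤ (p.hom ≫ π) ⁻¹ᵁ U)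
    (hU' : ⊤ ≤ ((p.comp h).hom ≫ π) ⁻¹ᵁ U) (σ : Γ(E, U)) :
    (p.comp h).value q U hU' σ = h.appTop (p.value q U hU σ) :=
  p.eval_comp h (π ⁻¹ᵁ U) hU hU' _

lemma value_scale (u : Γ(T, ⊤)ˣ) {U : S.Opens} (hU : ⊤ ≤ (p.hom ≫ π) ⁻¹ᵁ U) (σ : Γ(E, U)) :
    (p.scale u).value q U hU σ = u * p.value q U hU σ :=
  p.eval_scale u (π ⁻¹ᵁ U) hU _

lemma value_eq_sum {U V : S.Opens} {n : ℕ} {e : Fin n → Γ(E, U)} (he : IsFrame E U e) (h : V ≤ U)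
    (hV : ⊤ ≤ (p.hom ≫ π) ⁻¹ᵁ V) (hU : ⊤ ≤ (p.hom ≫ π) ⁻¹ᵁ U) (σ : Γ(E, V)) :
    p.value q V hV σ =
      ∑ i, (p.hom ≫ π).appLE V ⊤ hV (he.coord h σ i) * p.value q U hU (e i) := by
  conv_lhs => rw [← he.sum_coord h σ, map_sum]
  simp only [value_smul, value_res _ _ _ hV hU]

lemma functional_quotientMap :
    (pullbackComp p.hom π).hom.app E ≫ functional (p.quotientMap q) =
      (pullback p.hom).map q ≫ functional p.map := by
  have h := homEquiv_pullbackComp p.hom π (functional (p.quotientMap q))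
  rw [Equiv.apply_symm_apply] at h
  conv_lhs at h =>
    rw [quotientMap, ← Category.assoc, ← Adjunction.homEquiv_naturality_right]
  rw [cancel_mono, EmbeddingLike.apply_eq_iff_eq, ← Equiv.symm_apply_eq] at h
  rw [← h, Adjunction.homEquiv_naturality_left_symm]

end TrivializedPoint

variable {q} (hP : E.IsProjectiveBundle π L q) {n : ℕ} {U : S.Opens} {e : Fin n → Γ(E, U)}
  (he : IsFrame E U e)

include hP he

lemma exists_trivializedPoint (f : T ⟶ S) (hf : ⊤ ≤ f ⁻¹ᵁ U) (l : Fin n → Γ(T, ⊤))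
    (hl : ∃ i, IsUnit (l i)) :
    ∃ p : TrivializedPoint L T, p.hom ≫ π = f ∧
      ∀ (hU : ⊤ ≤ (p.hom ≫ π) ⁻¹ᵁ U) (i : Fin n), p.value q U hU (e i) = l i := by
  obtain ⟨i, hi⟩ := hl
  have hr : E.IsInvertibleQuotient f (structureModule T) (functional (he.hom f hf l)) :=
    ⟨isLocallyFreeOfRank_structureModule T,
      epi_functional_of_isUnit _ hf (e i) (by rwa [he.evalTop_hom_self])⟩
  obtain ⟨g, ⟨rfl, ε, hε⟩, -⟩ := hP.existsUnique f _ _ hr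
  let p : TrivializedPoint L T :=
    ⟨g, (pullbackPushforwardAdjunction g).homEquiv _ _ ε.hom, by
      rw [functional, Equiv.symm_apply_apply]; infer_instance⟩
  have hp : p.quotientMap q = he.hom (g ≫ π) hf l := by
    have h := p.functional_quotientMap q
    simp only [p, functional, Equiv.symm_apply_apply, hε] at h
    simpa [pullbackCongr] using h
  refine ⟨p, rfl, fun hU i ↦ ?_⟩
  rw [TrivializedPoint.value, hp]
  exact he.evalTop_hom_self (g ≫ π) hf l i

lemma trivializedPoint_ext {p p' : TrivializedPoint L T} (h : p.hom ≫ π = p'.hom ≫ π)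
    (hU : ⊤ ≤ (p.hom ≫ π) ⁻¹ᵁ U) (hU' : ⊤ ≤ (p'.hom ≫ π) ⁻¹ᵁ U)
    (hvalue : ∀ i, p.value q U hU (e i) = p'.value q U hU' (e i))
    (hunit : ∃ i, IsUnit (p.value q U hU (e i))) : p = p' := by
  obtain ⟨i, hi⟩ := hunit
  have hr : E.IsInvertibleQuotient (p.hom ≫ π) (structureModule T)
      (functional (p.quotientMap q)) :=
    ⟨isLocallyFreeOfRank_structureModule T, epi_functional_of_isUnit _ hU (e i) hi⟩
  have hhom : p.hom = p'.hom := by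
    refine (hP.existsUnique _ _ _ hr).unique ⟨rfl, asIso (functional p.map), ?_⟩
      ⟨h.symm, asIso (functional p'.map), ?_⟩
    · simpa [pullbackCongr] using (p.functional_quotientMap q).symm
    · refine (p'.functional_quotientMap q).symm.trans ?_
      congr 1
      exact he.functional_congr h.symm hU hU' hvalue
  obtain ⟨g, α, _⟩ := p
  obtain ⟨g', α', _⟩ := p'
  obtain rfl : g = g' := hhom
  have hquot := he.hom_ext hU hvalue
  rw [TrivializedPoint.quotientMap, TrivializedPoint.quotientMap, ← Category.assoc,
    ← Category.assoc, cancel_mono, ← Adjunction.homEquiv_naturality_right,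
    ← Adjunction.homEquiv_naturality_right, EmbeddingLike.apply_eq_iff_eq] at hquot
  have := hP.isInvertibleQuotient.epi
  obtain rfl : α = α' := (cancel_epi q).1 hquot
  rfl

end ProjectiveBundle

/-! ### Points with values in affine schemes and in local rings -/

section AffinePoints

variable {S T : Scheme.{u}} {U : S.Opens}

lemma toSpecΓ_specMap_appTop {R : CommRingCat.{u}} (φ : R ⟶ Γ(T, ⊤)) (a : R) :
    (T.toSpecΓ ≫ Spec.map φ).appTop ((Scheme.ΓSpecIso R).inv a) = φ a := by
  rw [← ConcreteCategory.comp_apply, Scheme.Hom.comp_appTop, ← Category.assoc,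
    ← Scheme.ΓSpecIso_inv_naturality, Scheme.toSpecΓ_appTop]
  simp

lemma le_preimage_specMap_fromSpec (hU : IsAffineOpen U) {R : CommRingCat.{u}} (φ : Γ(S, U) ⟶ R) :
    ⊤ ≤ (Spec.map φ ≫ hU.fromSpec) ⁻¹ᵁ U := by
  simp

lemma specMap_fromSpec_appLE (hU : IsAffineOpen U) {R : CommRingCat.{u}} (φ : Γ(S, U) ⟶ R)
    (h : ⊤ ≤ (Spec.map φ ≫ hU.fromSpec) ⁻¹ᵁ U) :
    (Spec.map φ ≫ hU.fromSpec).appLE U ⊤ h = φ ≫ (Scheme.ΓSpecIso R).inv := by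
  rw [Scheme.Hom.comp_appLE, hU.fromSpec_app_self, Scheme.ΓSpecIso_inv_naturality, Category.assoc]
  congr 1

lemma toSpecΓ_specMap_appLE_fromSpec (hU : IsAffineOpen U) (f : T ⟶ S) (hf : ⊤ ≤ f ⁻¹ᵁ U) :
    T.toSpecΓ ≫ Spec.map (f.appLE U ⊤ hf) ≫ hU.fromSpec = f := by
  have : IsIso (⊤ : T.Opens).ι := inferInstanceAs (IsIso T.topIso.hom)
  rw [← cancel_epi (⊤ : T.Opens).ι, ← Category.assoc, ← Scheme.Opens.toSpecΓ_top,
    Scheme.Opens.toSpecΓ_SpecMap_appLE_assoc, hU.toSpecΓ_fromSpec, Scheme.Hom.resLE_comp_ι]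

variable {x : S} (hx : x ∈ U) {R : CommRingCat.{u}} (ρ : S.presheaf.stalk x ⟶ R)

include hx in
lemma le_preimage_fromSpecStalk : ⊤ ≤ S.fromSpecStalk x ⁻¹ᵁ U := by
  intro y _
  have : S.fromSpecStalk x y ∈ Set.range (S.fromSpecStalk x) := ⟨y, rfl⟩
  rw [Scheme.range_fromSpecStalk] at this
  exact this.mem_open U.2 hx

include hx in
lemma le_preimage_specMap_fromSpecStalk : ⊤ ≤ (Spec.map ρ ≫ S.fromSpecStalk x) ⁻¹ᵁ U :=
  fun _ _ ↦ le_preimage_fromSpecStalk hx trivial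

lemma fromSpecStalk_appLE (h : ⊤ ≤ S.fromSpecStalk x ⁻¹ᵁ U) :
    (S.fromSpecStalk x).appLE U ⊤ h =
      S.presheaf.germ U x hx ≫ (Scheme.ΓSpecIso (S.presheaf.stalk x)).inv := by
  rw [Scheme.Hom.appLE, Scheme.fromSpecStalk_app hx, Category.assoc, Category.assoc,
    ← Functor.map_comp]
  congr 1

lemma specMap_fromSpecStalk_appLE (h : ⊤ ≤ (Spec.map ρ ≫ S.fromSpecStalk x) ⁻¹ᵁ U) :
    (Spec.map ρ ≫ S.fromSpecStalk x).appLE U ⊤ h =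
      S.presheaf.germ U x hx ≫ ρ ≫ (Scheme.ΓSpecIso R).inv := by
  rw [← Scheme.Hom.appLE_comp_appLE _ _ U ⊤ ⊤ (le_preimage_fromSpecStalk hx) le_rfl,
    fromSpecStalk_appLE hx, Category.assoc, Scheme.ΓSpecIso_inv_naturality]
  exact congrArg (fun t ↦ S.presheaf.germ U x hx ≫ (Scheme.ΓSpecIso _).inv ≫ t)
    (appLE_top_top (Spec.map ρ) _)

end AffinePoints

/-! ### Global sections of the tautological line bundle -/

section SectionsOfTautologicalBundle

variable {S P : Scheme.{u}} {E : S.Modules} {π : P ⟶ S} {L : P.Modules}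
  {q : (pullback π).obj E ⟶ L} {n : ℕ} {U U' : S.Opens}

lemma TrivializedPoint.value_eq_sum_germ {e : Fin n → Γ(E, U)} (he : IsFrame E U e)
    {R : CommRingCat.{u}} (p : TrivializedPoint L (Spec R)) {x : S} {ρ : S.presheaf.stalk x ⟶ R}
    (hp : p.hom ≫ π = Spec.map ρ ≫ S.fromSpecStalk x) {V : S.Opens} (h : V ≤ U) (hx : x ∈ V)
    (hV : ⊤ ≤ (p.hom ≫ π) ⁻¹ᵁ V) (hU : ⊤ ≤ (p.hom ≫ π) ⁻¹ᵁ U) (σ : Γ(E, V)) :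
    p.value q V hV σ =
      ∑ i, (Scheme.ΓSpecIso R).inv (ρ (S.presheaf.germ V x hx (he.coord h σ i))) *
        p.value q U hU (e i) := by
  have happ : (p.hom ≫ π).appLE V ⊤ hV =
      S.presheaf.germ V x hx ≫ ρ ≫ (Scheme.ΓSpecIso R).inv := by
    rw [← specMap_fromSpecStalk_appLE hx ρ (le_preimage_specMap_fromSpecStalk hx ρ)]
    congr 1
  rw [p.value_eq_sum q he h hV hU, happ]
  rfl

lemma comp_eq_scale (hP : E.IsProjectiveBundle π L q) {e : Fin n → Γ(E, U)} (he : IsFrame E U e)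
    {T T₀ : Scheme.{u}} {p : TrivializedPoint L T} {p₀ : TrivializedPoint L T₀} {h : T ⟶ T₀}
    (hh : h ≫ p₀.hom ≫ π = p.hom ≫ π) (hU : ⊤ ≤ (p.hom ≫ π) ⁻¹ᵁ U)
    (hU₀ : ⊤ ≤ (p₀.hom ≫ π) ⁻¹ᵁ U) {u : Γ(T, ⊤)ˣ}
    (hvalue : ∀ i, h.appTop (p₀.value q U hU₀ (e i)) = u * p.value q U hU (e i))
    (hunit : ∃ i, IsUnit (p.value q U hU (e i))) : p₀.comp h = p.scale u := by
  have hcomp : (p₀.comp h).hom ≫ π = (p.scale u).hom ≫ π := (Category.assoc _ _ _).trans hh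
  have hU' : ⊤ ≤ ((p₀.comp h).hom ≫ π) ⁻¹ᵁ U := by rwa [hcomp]
  have hvalue' (i : Fin n) :
      (p₀.comp h).value q U hU' (e i) = (p.scale u).value q U hU (e i) := by
    rw [p₀.value_comp q h hU₀, hvalue, p.value_scale q u hU]
  refine trivializedPoint_ext hP he hcomp hU' hU hvalue' (hunit.imp fun i hi ↦ ?_)
  rw [p₀.value_comp q h hU₀, hvalue]
  exact u.isUnit.mul hi

variable (q) in
/-- The section `s` of the tautological bundle is given over `U`, in terms of the homogeneous
coordinates `e`, by `eⱼ * F(eⱼ' / eⱼ)` at the points where `eⱼ` is invertible. -/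
def IsDehomogenization (e : Fin n → Γ(E, U)) (s : Γ(L, ⊤)) (j j' : Fin n)
    (F : Polynomial Γ(S, U)) : Prop :=
  ∀ ⦃T : Scheme.{u}⦄ (p : TrivializedPoint L T) (hU : ⊤ ≤ (p.hom ≫ π) ⁻¹ᵁ U) (v : Γ(T, ⊤)),
    p.value q U hU (e j) * v = 1 → p.evalGlobal s = p.value q U hU (e j) *
      F.eval₂ ((p.hom ≫ π).appLE U ⊤ hU).hom (p.value q U hU (e j') * v)

variable (q) in
/-- The section `s` of the tautological bundle is given over `U` by the section `σ` of `E`. The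
homogeneous coordinates of the points are required to contain a unit, rather than only to generate
the unit ideal. -/
def Represents (e : Fin n → Γ(E, U)) (s : Γ(L, ⊤)) (σ : Γ(E, U)) : Prop :=
  ∀ ⦃T : Scheme.{u}⦄ (p : TrivializedPoint L T) (hU : ⊤ ≤ (p.hom ≫ π) ⁻¹ᵁ U),
    (∃ i, IsUnit (p.value q U hU (e i))) → p.evalGlobal s = p.value q U hU σ

-- `F` is the value of `s` at the universal point `(1 : X)` over `U[X]`.
lemma exists_isDehomogenization (hP : E.IsProjectiveBundle π L q) (hU : IsAffineOpen U)
    {e : Fin 2 → Γ(E, U)} (he : IsFrame E U e) (s : Γ(L, ⊤)) {j j' : Fin 2} (hj : j ≠ j') :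
    ∃ F, IsDehomogenization q e s j j' F := by
  let R := CommRingCat.of (Polynomial Γ(S, U))
  let f₀ : Spec R ⟶ S := Spec.map (CommRingCat.ofHom Polynomial.C) ≫ hU.fromSpec
  let t : Γ(Spec R, ⊤) := (Scheme.ΓSpecIso R).inv Polynomial.X
  have hf₀ : ⊤ ≤ f₀ ⁻¹ᵁ U := le_preimage_specMap_fromSpec hU _
  obtain ⟨p₀, hp₀, hvalue₀⟩ := exists_trivializedPoint hP he f₀ hf₀
    (fun i ↦ if i = j then 1 else t) ⟨j, by simp⟩
  have hU₀ : ⊤ ≤ (p₀.hom ≫ π) ⁻¹ᵁ U := by rwa [hp₀]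
  refine ⟨(Scheme.ΓSpecIso R).hom (p₀.evalGlobal s), fun T p hUp v hv ↦ ?_⟩
  let φ := Polynomial.eval₂RingHom ((p.hom ≫ π).appLE U ⊤ hUp).hom (p.value q U hUp (e j') * v)
  let h : T ⟶ Spec R := T.toSpecΓ ≫ Spec.map (CommRingCat.ofHom φ)
  have happ (a : R) : h.appTop ((Scheme.ΓSpecIso R).inv a) = φ a := toSpecΓ_specMap_appTop _ a
  have hh : h ≫ p₀.hom ≫ π = p.hom ≫ π := by
    rw [hp₀, ← toSpecΓ_specMap_appLE_fromSpec hU (p.hom ≫ π) hUp]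
    simp only [h, f₀, Category.assoc, ← Spec.map_comp_assoc]
    congr 3
    exact CommRingCat.hom_ext (RingHom.ext fun a ↦ Polynomial.eval₂_C _ _)
  let u : Γ(T, ⊤)ˣ := Units.mkOfMulEqOne v _ ((mul_comm _ _).trans hv)
  have hvalue (i : Fin 2) : h.appTop (p₀.value q U hU₀ (e i)) = u * p.value q U hUp (e i) := by
    rw [hvalue₀]
    split_ifs with hi
    · rw [map_one, hi]
      exact ((mul_comm _ _).trans hv).symm
    · obtain rfl : i = j' := by omega
      rw [happ]
      exact (Polynomial.eval₂_X _ _).trans (mul_comm _ _)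
  have hcomp := comp_eq_scale hP he hh hUp hU₀ hvalue ⟨j, .of_mul_eq_one v hv⟩
  have heval : h.appTop (p₀.evalGlobal s) = u * p.evalGlobal s := by
    rw [← p₀.evalGlobal_comp h, hcomp, p.evalGlobal_scale]
  have hφ := happ ((Scheme.ΓSpecIso R).hom (p₀.evalGlobal s))
  rw [Iso.hom_inv_id_apply, heval] at hφ
  change _ = _ * φ _
  rw [← hφ, ← mul_assoc]
  exact (one_mul _).symm.trans (congrArg (· * _) hv.symm)

section Polynomial

open Polynomial

variable {R : Type*} [CommRing R]

lemma toLaurent_eq_eval₂ (p : R[X]) :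
    toLaurent p = p.eval₂ LaurentPolynomial.C (LaurentPolynomial.T 1) :=
  RingHom.congr_fun (ringHom_ext (f := toLaurent)
    (g := eval₂RingHom LaurentPolynomial.C (LaurentPolynomial.T 1)) (by simp) (by simp)) p

lemma coeff_toLaurent_natCast (p : R[X]) (n : ℕ) : (toLaurent p).coeff (n : ℤ) = p.coeff n := by
  rw [LaurentPolynomial.coeff_toLaurent]
  exact Finsupp.mapDomain_apply Nat.castEmbedding.injective _ _

lemma coeff_toLaurent_of_neg (p : R[X]) {n : ℤ} (hn : n < 0) : (toLaurent p).coeff n = 0 := by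
  rw [LaurentPolynomial.coeff_toLaurent]
  refine Finsupp.mapDomain_of_notMem_range _ _ ?_
  rintro ⟨m, rfl⟩
  exact absurd hn (by simp)

lemma exists_eq_C_add_C_mul_X_of_toLaurent_eq {p q : R[X]}
    (h : toLaurent p = LaurentPolynomial.T 1 * LaurentPolynomial.invert (toLaurent q)) :
    ∃ a b : R, p = C a + C b * X ∧ q = C b + C a * X := by
  have hcoeff (n : ℤ) : (toLaurent p).coeff n = (toLaurent q).coeff (1 - n) := by
    rw [h]
    refine (AddMonoidAlgebra.coeff_single_mul_apply _ _ _ _).trans ?_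
    rw [one_mul, LaurentPolynomial.invert_apply, neg_add_rev, neg_neg, add_comm, sub_eq_add_neg]
  refine ⟨p.coeff 0, p.coeff 1, ?_, ?_⟩
  · ext n
    match n with
    | 0 => simp
    | 1 => simp
    | n + 2 =>
      rw [← coeff_toLaurent_natCast, hcoeff, coeff_toLaurent_of_neg _ (by push_cast; omega)]
      simp
  · ext n
    match n with
    | 0 =>
      have h₀₁ : q.coeff 0 = p.coeff 1 := by
        rw [← coeff_toLaurent_natCast, ← coeff_toLaurent_natCast]
        exact (hcoeff 1).symm
      simpa using h₀₁
    | 1 =>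
      have h₁₀ : q.coeff 1 = p.coeff 0 := by
        rw [← coeff_toLaurent_natCast, ← coeff_toLaurent_natCast]
        exact (hcoeff 0).symm
      simpa using h₁₀
    | n + 2 =>
      have hn := hcoeff (1 - (n + 2 : ℕ))
      rw [sub_sub_cancel, coeff_toLaurent_natCast,
        coeff_toLaurent_of_neg _ (by push_cast; omega)] at hn
      rw [← hn]
      simp

end Polynomial

-- Compare the two expressions for `s` at the universal point `(1 : t) = (t⁻¹ : 1)` over
-- `U[t, t⁻¹]`.
open LaurentPolynomial in
lemma IsDehomogenization.toLaurent_eq (hP : E.IsProjectiveBundle π L q) (hU : IsAffineOpen U)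
    {e : Fin 2 → Γ(E, U)} (he : IsFrame E U e) {s : Γ(L, ⊤)} {F₀ F₁ : Polynomial Γ(S, U)}
    (h₀ : IsDehomogenization q e s 0 1 F₀) (h₁ : IsDehomogenization q e s 1 0 F₁) :
    Polynomial.toLaurent F₀ = T 1 * invert (Polynomial.toLaurent F₁) := by
  let R := CommRingCat.of (LaurentPolynomial Γ(S, U))
  let f₀ : Spec R ⟶ S := Spec.map (CommRingCat.ofHom C) ≫ hU.fromSpec
  let ι := (Scheme.ΓSpecIso R).inv.hom
  have hf₀ : ⊤ ≤ f₀ ⁻¹ᵁ U := le_preimage_specMap_fromSpec hU _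
  obtain ⟨p, hp, hvalue⟩ := exists_trivializedPoint hP he f₀ hf₀ ![1, ι (T 1)] ⟨0, by simp⟩
  have hUp : ⊤ ≤ (p.hom ≫ π) ⁻¹ᵁ U := by rwa [hp]
  have happ : ((p.hom ≫ π).appLE U ⊤ hUp).hom = ι.comp C := by
    have : (p.hom ≫ π).appLE U ⊤ hUp = f₀.appLE U ⊤ hf₀ := by congr 1
    rw [this, specMap_fromSpec_appLE]
    rfl
  have hT : ι (T 1) * ι (T (-1)) = 1 := by
    rw [← map_mul, ← T_add, add_neg_cancel, T_zero, map_one]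
  have heval₀ := h₀ p hUp 1 (by simp [hvalue])
  have heval₁ := h₁ p hUp (ι (T (-1))) (by simpa [hvalue] using hT)
  simp only [hvalue, happ, Matrix.cons_val_zero, Matrix.cons_val_one, one_mul, mul_one,
    ← Polynomial.hom_eval₂] at heval₀ heval₁
  rw [heval₀, ← map_mul] at heval₁
  rw [toLaurent_eq_eval₂, (Scheme.ΓSpecIso R).symm.commRingCatIsoToRingEquiv.injective heval₁,
    ← AlgEquiv.coe_ringEquiv, ← RingEquiv.coe_toRingHom, toLaurent_eq_eval₂, Polynomial.hom_eval₂]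
  congr 2
  · ext; simp
  · simp

lemma IsDehomogenization.eval_eq_of_linear {e : Fin n → Γ(E, U)} {s : Γ(L, ⊤)} {j j' : Fin n}
    {a b : Γ(S, U)} (h : IsDehomogenization q e s j j' (.C a + .C b * .X))
    {T : Scheme.{u}} (p : TrivializedPoint L T) (hU : ⊤ ≤ (p.hom ≫ π) ⁻¹ᵁ U)
    (hj : IsUnit (p.value q U hU (e j))) :
    p.evalGlobal s = p.value q U hU (a • e j + b • e j') := by
  obtain ⟨v, hv⟩ := hj.exists_right_inv
  rw [h p hU v hv, map_add, p.value_smul, p.value_smul]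
  simp only [Polynomial.eval₂_add, Polynomial.eval₂_mul, Polynomial.eval₂_C, Polynomial.eval₂_X]
  change _ * (((p.hom ≫ π).appLE U ⊤ hU) a + ((p.hom ≫ π).appLE U ⊤ hU) b * _) = _
  linear_combination ((p.hom ≫ π).appLE U ⊤ hU b * p.value q U hU (e j')) * hv

lemma exists_represents (hP : E.IsProjectiveBundle π L q) (hU : IsAffineOpen U)
    {e : Fin 2 → Γ(E, U)} (he : IsFrame E U e) (s : Γ(L, ⊤)) : ∃ σ, Represents q e s σ := by
  obtain ⟨F₀, h₀⟩ := exists_isDehomogenization hP hU he s zero_ne_one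
  obtain ⟨F₁, h₁⟩ := exists_isDehomogenization hP hU he s one_ne_zero
  obtain ⟨a, b, rfl, rfl⟩ :=
    exists_eq_C_add_C_mul_X_of_toLaurent_eq (h₀.toLaurent_eq hP hU he h₁)
  refine ⟨a • e 0 + b • e 1, fun _ p hUp hunit ↦ ?_⟩
  rcases Fin.exists_fin_two.1 hunit with hunit | hunit
  · exact h₀.eval_eq_of_linear p hUp hunit
  · rw [h₁.eval_eq_of_linear p hUp hunit, add_comm]

lemma Represents.map_inf_eq (hP : E.IsProjectiveBundle π L q) {e : Fin n → Γ(E, U)}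
    {e' : Fin n → Γ(E, U')} (he : IsFrame E U e) (he' : IsFrame E U' e') {s : Γ(L, ⊤)}
    {σ : Γ(E, U)} {σ' : Γ(E, U')} (h : Represents q e s σ) (h' : Represents q e' s σ') :
    E.presheaf.map (homOfLE (inf_le_left : U ⊓ U' ≤ U)).op σ =
      E.presheaf.map (homOfLE (inf_le_right : U ⊓ U' ≤ U')).op σ' := by
  apply (he.coord inf_le_left).injective
  ext i
  refine TopCat.Presheaf.section_ext S.sheaf _ _ _ fun z hz ↦ ?_
  let ρ := 𝟙 (S.presheaf.stalk z)
  obtain ⟨p, hp, hvalue⟩ := exists_trivializedPoint hP he (Spec.map ρ ≫ S.fromSpecStalk z)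
    (le_preimage_specMap_fromSpecStalk hz.1 ρ) (Pi.single i 1) ⟨i, by simp⟩
  have hU : ⊤ ≤ (p.hom ≫ π) ⁻¹ᵁ U := hp ▸ le_preimage_specMap_fromSpecStalk hz.1 ρ
  have hU' : ⊤ ≤ (p.hom ≫ π) ⁻¹ᵁ U' := hp ▸ le_preimage_specMap_fromSpecStalk hz.2 ρ
  have hV : ⊤ ≤ (p.hom ≫ π) ⁻¹ᵁ (U ⊓ U') := le_inf hU hU'
  have hvalueV (τ : Γ(E, U ⊓ U')) : p.value q _ hV τ =
      (Scheme.ΓSpecIso _).inv (S.presheaf.germ _ z hz (he.coord inf_le_left τ i)) := by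
    rw [p.value_eq_sum_germ he hp inf_le_left hz hV hU]
    simp only [hvalue, Pi.single_apply, mul_ite, mul_one, mul_zero, Finset.sum_ite_eq',
      Finset.mem_univ, if_true]
    rfl
  have hunit' : ∃ j, IsUnit (p.value q U' hU' (e' j)) := by
    have : IsLocalRing Γ(Spec (S.presheaf.stalk z), ⊤) :=
      (Scheme.ΓSpecIso _).symm.commRingCatIsoToRingEquiv.isLocalRing
    have hone := p.value_res q (homOfLE (inf_le_left : U ⊓ U' ≤ U)) hV hU (e i)
    rw [hvalue, Pi.single_eq_same, p.value_eq_sum q he' inf_le_right hV hU'] at hone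
    obtain ⟨j, -, hj⟩ := IsLocalRing.exists_of_isUnit_sum (hone ▸ isUnit_one)
    exact ⟨j, isUnit_of_mul_isUnit_right hj⟩
  refine (Scheme.ΓSpecIso _).symm.commRingCatIsoToRingEquiv.injective ?_
  refine (hvalueV _).symm.trans (Eq.trans ?_ (hvalueV _))
  rw [p.value_res q _ hV hU, p.value_res q _ hV hU', ← h p hU ⟨i, by simp [hvalue]⟩,
    h' p hU' hunit']

/-- A choice, for every point of `S`, of a frame of `E` over an affine open neighbourhood. -/
structure AffineFrameCover (E : S.Modules) (n : ℕ) where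
  /-- The neighbourhoods. -/
  opens : S → S.Opens
  isAffineOpen : ∀ x, IsAffineOpen (opens x)
  mem : ∀ x, x ∈ opens x
  /-- The frames. -/
  frame : ∀ x, Fin n → Γ(E, opens x)
  isFrame : ∀ x, IsFrame E (opens x) (frame x)

lemma nonempty_affineFrameCover (hE : E.IsLocallyFreeOfRank n) :
    Nonempty (AffineFrameCover E n) := by
  have (x : S) : ∃ (U : S.Opens) (e : Fin n → Γ(E, U)),
      IsAffineOpen U ∧ x ∈ U ∧ IsFrame E U e := by
    obtain ⟨V, hV, e, he⟩ := hE x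
    obtain ⟨U, hU, hx, hUV⟩ := Opens.isBasis_iff_nbhd.1 S.isBasis_affineOpens hV
    exact ⟨U, _, hU, hx, IsFrame.mono he hUV⟩
  choose U e h using this
  exact ⟨U, fun x ↦ (h x).1, fun x ↦ (h x).2.1, e, fun x ↦ (h x).2.2⟩

lemma exists_represents_globalRes (hP : E.IsProjectiveBundle π L q) (F : AffineFrameCover E 2)
    (s : Γ(L, ⊤)) :
    ∃ σ : Γ(E, ⊤), ∀ x, Represents q (F.frame x) s (E.globalRes (F.opens x) σ) := by
  choose τ hτ using fun x ↦ exists_represents hP (F.isAffineOpen x) (F.isFrame x) s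
  obtain ⟨σ, hσ, -⟩ := TopCat.Sheaf.existsUnique_gluing' ⟨E.presheaf, E.isSheaf⟩ F.opens ⊤
    (fun _ ↦ homOfLE le_top) (fun x _ ↦ Opens.mem_iSup.2 ⟨x, F.mem x⟩) τ
    (fun x y ↦ (hτ x).map_inf_eq hP (F.isFrame x) (F.isFrame y) (hτ y))
  refine ⟨σ, fun x ↦ ?_⟩
  have hx : E.globalRes (F.opens x) σ = τ x := hσ x
  exact hx ▸ hτ x

end SectionsOfTautologicalBundle

/-! ### Morphisms to projective space -/

section ProjectiveSpace

lemma basicOpen_toSpecΓ_specMap_awayι {A σ : Type*} [CommRing A] [SetLike σ A]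
    [AddSubgroupClass σ A] (𝒜 : ℕ → σ) [GradedRing 𝒜] {f : A} {m : ℕ} (hf : f ∈ 𝒜 m)
    (hm : 0 < m) :
    (Proj.basicOpen 𝒜 f).toSpecΓ ≫ Spec.map (Proj.awayToSection 𝒜 f) ≫ Proj.awayι 𝒜 f hf hm =
      (Proj.basicOpen 𝒜 f).ι := by
  rw [Proj.awayι, ← Category.assoc]
  change Proj.basicOpenToSpec _ _ ≫ _ = _
  rw [← Proj.basicOpenIsoSpec_hom _ _ hf hm, Iso.hom_inv_id_assoc]

open MvPolynomial PSpace

variable (k : Type u) [Field k] {n : ℕ}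

lemma X_mem_homogeneousSubmodule (i : Fin (n + 1)) :
    X i ∈ homogeneousSubmodule (Fin (n + 1)) k 1 :=
  (mem_homogeneousSubmodule 1 _).2 (isHomogeneous_X k i)

/-- The coordinate ring `k[x₀ / xⱼ, …, xₙ / xⱼ]` of the standard open set `D₊(xⱼ)`. -/
abbrev ChartRing (j : Fin (n + 1)) : Type u :=
  HomogeneousLocalization.Away (homogeneousSubmodule (Fin (n + 1)) k) (X j)

/-- The element `xᵢ / xⱼ` of the coordinate ring of `D₊(xⱼ)`, which the map to the regular
functions on `D₊(xⱼ)` sends to `PSpace.ratio k i j`. -/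
def chartRatio (i j : Fin (n + 1)) : ChartRing k j :=
  HomogeneousLocalization.Away.mk (homogeneousSubmodule (Fin (n + 1)) k)
    (X_mem_homogeneousSubmodule k j) 1 (X i)
    ((one_smul ℕ 1).symm ▸ X_mem_homogeneousSubmodule k i)

/-- The inclusion of the constants in the coordinate ring of `D₊(xⱼ)`. -/
def chartC (j : Fin (n + 1)) : k →+* ChartRing k j :=
  (HomogeneousLocalization.fromZeroRingHom _ _).comp
    (algebraMap k (homogeneousSubmodule (Fin (n + 1)) k 0))

/-- The open immersion of `D₊(xⱼ)`. -/
def chartι (j : Fin (n + 1)) : Spec (.of (ChartRing k j)) ⟶ PSpace k n :=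
  Proj.awayι _ _ (X_mem_homogeneousSubmodule k j) zero_lt_one

lemma iSup_chart : ⨆ j : Fin (n + 1), chart k j = ⊤ := by
  refine Proj.iSup_basicOpen_eq_top' _ _ (fun i ↦ ⟨1, X_mem_homogeneousSubmodule k i⟩) ?_
  rw [eq_top_iff]
  intro p _
  have : p ∈ Algebra.adjoin k (Set.range (X : Fin (n + 1) → MvPolynomial (Fin (n + 1)) k)) :=
    adjoin_range_X (R := k) (σ := Fin (n + 1)) ▸ trivial
  induction this using Algebra.adjoin_induction with
  | mem x hx => exact Algebra.subset_adjoin hx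
  | algebraMap r =>
    exact Subalgebra.algebraMap_mem _ (algebraMap k (homogeneousSubmodule (Fin (n + 1)) k 0) r)
  | add x y _ _ hx hy => exact add_mem (hx trivial) (hy trivial)
  | mul x y _ _ hx hy => exact mul_mem (hx trivial) (hy trivial)

variable {k}

lemma chartι_toSpec (j : Fin (n + 1)) :
    chartι k j ≫ toSpec k n = Spec.map (CommRingCat.ofHom (chartC k j)) := by
  rw [chartι, toSpec]
  erw [Proj.awayι_toSpecZero_assoc]
  rw [← Spec.map_comp]
  rfl

lemma chartι_preimage_chart (i j : Fin (n + 1)) :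
    chartι k j ⁻¹ᵁ chart k i = PrimeSpectrum.basicOpen (chartRatio k i j) := by
  refine (Proj.awayι_preimage_basicOpen (homogeneousSubmodule (Fin (n + 1)) k)
    (X_mem_homogeneousSubmodule k j) zero_lt_one (X_mem_homogeneousSubmodule k i)
    zero_lt_one).trans ?_
  congr 1
  simp [HomogeneousLocalization.Away.isLocalizationElem, chartRatio]

lemma algebraMap_X_eq (i j : Fin (n + 1)) :
    algebraMap (MvPolynomial (Fin (n + 1)) k) (Localization.Away (X (R := k) j)) (X i) =
      algebraMap (ChartRing k j) (Localization.Away (X (R := k) j)) (chartRatio k i j) *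
        algebraMap (MvPolynomial (Fin (n + 1)) k) (Localization.Away (X (R := k) j)) (X j) := by
  rw [HomogeneousLocalization.algebraMap_apply, chartRatio, HomogeneousLocalization.Away.val_mk,
    Localization.mk_eq_mk'_apply]
  simp

lemma away_mk_eq_eval₂ (j : Fin (n + 1)) (m : ℕ) (p : MvPolynomial (Fin (n + 1)) k) (hp) :
    HomogeneousLocalization.Away.mk (homogeneousSubmodule (Fin (n + 1)) k)
      (X_mem_homogeneousSubmodule k j) m p hp =
      p.eval₂ (chartC k j) (fun i ↦ chartRatio k i j) := by
  apply HomogeneousLocalization.val_injective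
  have hp' : p.IsHomogeneous m := by simpa using hp
  have hC : (algebraMap _ (Localization.Away (X (R := k) j))).comp (chartC k j) =
      algebraMap k (Localization.Away (X (R := k) j)) :=
    RingHom.ext fun c ↦ Localization.mk_one_eq_algebraMap _
  rw [HomogeneousLocalization.Away.val_mk, ← HomogeneousLocalization.algebraMap_apply, hom_eval₂,
    Localization.mk_eq_mk'_apply, IsLocalization.mk'_eq_iff_eq_mul, hC]
  conv_lhs => rw [← eval₂_eta p]
  rw [hom_eval₂, eval₂_eq, eval₂_eq, Finset.sum_mul]
  refine Finset.sum_congr rfl fun d hd ↦ ?_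
  rw [mul_assoc]
  congr 1
  rw [Finset.prod_congr rfl fun i _ ↦ congrArg (· ^ d i) (algebraMap_X_eq i j)]
  simp only [mul_pow, Finset.prod_mul_distrib, Finset.prod_pow_eq_pow_sum, map_pow]
  congr 2
  exact (hp'.degree_eq_sum_deg_support hd).symm

lemma chartRing_hom_ext {R : Type*} [CommRing R] {j : Fin (n + 1)} {F G : ChartRing k j →+* R}
    (hC : F.comp (chartC k j) = G.comp (chartC k j))
    (hX : ∀ i, F (chartRatio k i j) = G (chartRatio k i j)) : F = G := by
  ext a
  obtain ⟨m, p, hp, rfl⟩ :=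
    HomogeneousLocalization.Away.mk_surjective _ (X_mem_homogeneousSubmodule k j) a
  rw [away_mk_eq_eval₂, hom_eval₂, hom_eval₂, hC]
  congr 1
  exact funext hX

variable {T : Scheme.{u}}

lemma toSpecΓ_specMap_injective {R : CommRingCat.{u}} {a b : R ⟶ Γ(T, ⊤)}
    (h : T.toSpecΓ ≫ Spec.map a = T.toSpecΓ ≫ Spec.map b) : a = b := by
  ext r
  rw [← toSpecΓ_specMap_appTop a, h, toSpecΓ_specMap_appTop]

/-- The isomorphism from the coordinate ring of `D₊(xⱼ)` to the regular functions on it. -/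
def chartRingToSections (j : Fin (n + 1)) :
    CommRingCat.of (ChartRing k j) ⟶ Γ(PSpace k n, chart k j) :=
  Proj.awayToSection _ _

lemma toSpecΓ_specMap_chartRingToSections (j : Fin (n + 1)) :
    (chart k j).toSpecΓ ≫ Spec.map (chartRingToSections j) ≫ chartι k j = (chart k j).ι :=
  basicOpen_toSpecΓ_specMap_awayι _ _ _

/-- The homomorphism of rings corresponding to a morphism to the chart `D₊(xⱼ)`. -/
def chartHom {j : Fin (n + 1)} (ψ : T ⟶ PSpace k n) (h : ⊤ ≤ ψ ⁻¹ᵁ chart k j) :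
    CommRingCat.of (ChartRing k j) ⟶ Γ(T, ⊤) :=
  chartRingToSections j ≫ ψ.appLE (chart k j) ⊤ h

lemma toSpecΓ_specMap_chartHom {j : Fin (n + 1)} (ψ : T ⟶ PSpace k n)
    (h : ⊤ ≤ ψ ⁻¹ᵁ chart k j) : T.toSpecΓ ≫ Spec.map (chartHom ψ h) ≫ chartι k j = ψ := by
  have : IsIso (⊤ : T.Opens).ι := inferInstanceAs (IsIso T.topIso.hom)
  rw [← cancel_epi (⊤ : T.Opens).ι, ← Category.assoc, ← Scheme.Opens.toSpecΓ_top, chartHom,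
    Spec.map_comp_assoc, Scheme.Opens.toSpecΓ_SpecMap_appLE_assoc,
    toSpecΓ_specMap_chartRingToSections, Scheme.Hom.resLE_comp_ι]

lemma comp_toSpec {j : Fin (n + 1)} (ψ : T ⟶ PSpace k n) (h : ⊤ ≤ ψ ⁻¹ᵁ chart k j) :
    ψ ≫ toSpec k n = T.toSpecΓ ≫ Spec.map (CommRingCat.ofHom (chartC k j) ≫ chartHom ψ h) := by
  conv_lhs => rw [← toSpecΓ_specMap_chartHom ψ h]
  rw [Spec.map_comp, Category.assoc, Category.assoc, chartι_toSpec]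

lemma hom_ext_of_chart {j : Fin (n + 1)} {ψ ψ' : T ⟶ PSpace k n}
    (hk : ψ ≫ toSpec k n = ψ' ≫ toSpec k n) (h : ⊤ ≤ ψ ⁻¹ᵁ chart k j) (h' : ⊤ ≤ ψ' ⁻¹ᵁ chart k j)
    (hr : ∀ i, ψ.appLE _ ⊤ h (ratio k i j) = ψ'.appLE _ ⊤ h' (ratio k i j)) : ψ = ψ' := by
  have hC : CommRingCat.ofHom (chartC k j) ≫ chartHom ψ h =
      CommRingCat.ofHom (chartC k j) ≫ chartHom ψ' h' :=
    toSpecΓ_specMap_injective ((comp_toSpec ψ h).symm.trans (hk.trans (comp_toSpec ψ' h')))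
  rw [← toSpecΓ_specMap_chartHom ψ h, ← toSpecΓ_specMap_chartHom ψ' h']
  congr 3
  exact CommRingCat.hom_ext (chartRing_hom_ext (congrArg CommRingCat.Hom.hom hC) hr)

lemma le_preimage_chart_of_isUnit {i j : Fin (n + 1)} {ψ : T ⟶ PSpace k n}
    (h : ⊤ ≤ ψ ⁻¹ᵁ chart k j) (hu : IsUnit (ψ.appLE _ ⊤ h (ratio k i j))) :
    ⊤ ≤ ψ ⁻¹ᵁ chart k i := by
  intro x _
  rw [← toSpecΓ_specMap_chartHom ψ h]
  change T.toSpecΓ x ∈ Spec.map (chartHom ψ h) ⁻¹ᵁ chartι k j ⁻¹ᵁ chart k i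
  rw [chartι_preimage_chart]
  exact fun hx ↦ (T.toSpecΓ x).2.ne_top (Ideal.eq_top_of_isUnit_mem _ hx hu)

lemma exists_le_preimage_chart {R : CommRingCat.{u}} [IsLocalRing R] (ψ : Spec R ⟶ PSpace k n) :
    ∃ j, ⊤ ≤ ψ ⁻¹ᵁ chart k j := by
  have : ψ (IsLocalRing.closedPoint R) ∈ ⨆ j : Fin (n + 1), chart k j := by
    rw [iSup_chart]; trivial
  obtain ⟨j, hj⟩ := Opens.mem_iSup.1 this
  exact ⟨j, ((IsLocalRing.closed_point_mem_iff (U := ψ ⁻¹ᵁ chart k j)).1 hj).ge⟩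

variable {P : Scheme.{u}} {L : P.Modules} {s : Fin (n + 1) → Γ(L, ⊤)} {φ : P ⟶ PSpace k n}
  (H : L.IsMorphismOfSections s φ)

include H

lemma isUnit_evalGlobal (p : TrivializedPoint L T) {j : Fin (n + 1)}
    (hj : ⊤ ≤ (p.hom ≫ φ) ⁻¹ᵁ chart k j) {V : P.Opens} {hV : ⊤ ≤ p.hom ⁻¹ᵁ V} {τ : Γ(L, V)}
    (hτ : IsUnit (p.eval V hV τ)) : IsUnit (p.evalGlobal (s j)) := by
  have hVj : ⊤ ≤ p.hom ⁻¹ᵁ (V ⊓ φ ⁻¹ᵁ chart k j) := le_inf hV hj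
  obtain ⟨a, ha⟩ := (H.bijective_smul j (V ⊓ φ ⁻¹ᵁ chart k j) inf_le_right).2
    (L.presheaf.map (homOfLE inf_le_left).op τ)
  have hres := evalTop_res p.map (homOfLE (inf_le_left : V ⊓ φ ⁻¹ᵁ chart k j ≤ V)) hVj hV τ
  rw [← ha, evalTop_smul, globalRes, evalTop_res p.map _ _ le_rfl] at hres
  exact isUnit_of_mul_isUnit_right (hres ▸ hτ)

lemma evalGlobal_eq_ratio_mul (p : TrivializedPoint L T) (i : Fin (n + 1)) {j : Fin (n + 1)}
    (hj : ⊤ ≤ (p.hom ≫ φ) ⁻¹ᵁ chart k j) :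
    p.evalGlobal (s i) = (p.hom ≫ φ).appLE _ ⊤ hj (ratio k i j) * p.evalGlobal (s j) := by
  have hj' : ⊤ ≤ p.hom ⁻¹ᵁ φ ⁻¹ᵁ chart k j := hj
  have hmul := (congrArg (evalTop p.map (φ ⁻¹ᵁ chart k j) hj') (H.eq_smul i j)).trans
    (evalTop_smul p.map (φ ⁻¹ᵁ chart k j) hj' _ _)
  rw [globalRes, globalRes, evalTop_res p.map _ _ le_rfl, evalTop_res p.map _ _ le_rfl] at hmul
  rw [Scheme.Hom.comp_appLE]
  exact hmul

lemma hom_eq_of_evalGlobal_eq [Mono φ] {R : CommRingCat.{u}} [IsLocalRing R]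
    {p p' : TrivializedPoint L (Spec R)}
    (hk : (p.hom ≫ φ) ≫ toSpec k n = (p'.hom ≫ φ) ≫ toSpec k n) {V : P.Opens}
    {hV : ⊤ ≤ p.hom ⁻¹ᵁ V} {τ : Γ(L, V)} (hτ : IsUnit (p.eval V hV τ))
    (hs : ∀ i, p.evalGlobal (s i) = p'.evalGlobal (s i)) : p.hom = p'.hom := by
  obtain ⟨j, hj⟩ := exists_le_preimage_chart (p.hom ≫ φ)
  obtain ⟨l, hl⟩ := exists_le_preimage_chart (p'.hom ≫ φ)
  have hunit := isUnit_evalGlobal H p hj hτ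
  have hj' : ⊤ ≤ (p'.hom ≫ φ) ⁻¹ᵁ chart k j := by
    refine le_preimage_chart_of_isUnit hl ?_
    rw [hs, evalGlobal_eq_ratio_mul H p' j hl] at hunit
    exact isUnit_of_mul_isUnit_left hunit
  refine (cancel_mono φ).1 (hom_ext_of_chart hk hj hj' fun i ↦ ?_)
  rw [← hunit.mul_left_inj, ← evalGlobal_eq_ratio_mul H p i hj, hs i, hs j,
    ← evalGlobal_eq_ratio_mul H p' i hj']

end ProjectiveSpace

/-! ### Separation of the points of the projective bundle by sections -/

section Separation

open Matrix

variable {S P : Scheme.{u}} {E : S.Modules} {n : ℕ}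

namespace AffineFrameCover

variable (F : AffineFrameCover E n) (x : S)

/-- The coordinates of the germ at `x` of a global section of `E`, with respect to the chosen
frame. -/
def coord : Γ(E, ⊤) →+ (Fin n → S.presheaf.stalk x) where
  toFun σ i := S.presheaf.germ (F.opens x) x (F.mem x)
    ((F.isFrame x).coord le_rfl (E.globalRes (F.opens x) σ) i)
  map_zero' := by ext; simp [globalRes]
  map_add' σ τ := by ext; simp [globalRes]

lemma coord_smul (a : Γ(S, ⊤)) (σ : Γ(E, ⊤)) :
    F.coord x (a • σ) = S.presheaf.germ ⊤ x (Opens.mem_top x) a • F.coord x σ := by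
  ext i
  have hres : E.globalRes (F.opens x) (a • σ) =
      S.presheaf.map (homOfLE le_top).op a • E.globalRes (F.opens x) σ :=
    E.map_smul (homOfLE le_top) a σ
  change S.presheaf.germ _ x _ ((F.isFrame x).coord le_rfl (E.globalRes _ (a • σ)) i) = _
  rw [hres, LinearEquiv.map_smul, Pi.smul_apply, smul_eq_mul, map_mul,
    TopCat.Presheaf.germ_res_apply]
  rfl

end AffineFrameCover

lemma exists_trivializedPoint_stalk {π : P ⟶ S} {L : P.Modules} {q : (pullback π).obj E ⟶ L}
    (hP : E.IsProjectiveBundle π L q) (F : AffineFrameCover E n) {x : S} {R : CommRingCat.{u}}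
    (ρ : S.presheaf.stalk x ⟶ R) {l : Fin n → R} (hl : ∃ i, IsUnit (l i)) :
    ∃ p : TrivializedPoint L (Spec R), p.hom ≫ π = Spec.map ρ ≫ S.fromSpecStalk x ∧
      (∃ (V : P.Opens) (hV : ⊤ ≤ p.hom ⁻¹ᵁ V) (τ : Γ(L, V)), IsUnit (p.eval V hV τ)) ∧
      ∀ s σ, Represents q (F.frame x) s (E.globalRes (F.opens x) σ) →
        p.evalGlobal s = (Scheme.ΓSpecIso R).inv ((ρ ∘ F.coord x σ) ⬝ᵥ l) := by
  have hx := le_preimage_specMap_fromSpecStalk (F.mem x) ρ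
  obtain ⟨p, hp, hvalue⟩ := exists_trivializedPoint hP (F.isFrame x) _ hx
    (fun i ↦ (Scheme.ΓSpecIso R).inv (l i)) (hl.imp fun i hi ↦ hi.map _)
  have hU : ⊤ ≤ (p.hom ≫ π) ⁻¹ᵁ F.opens x := hp ▸ hx
  have hunit : ∃ i, IsUnit (p.value q _ hU (F.frame x i)) :=
    hl.imp fun i hi ↦ by rw [hvalue]; exact hi.map _
  obtain ⟨i, hi⟩ := hunit
  refine ⟨p, hp, ⟨π ⁻¹ᵁ F.opens x, hU, _, hi⟩, fun s σ hσ ↦ ?_⟩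
  rw [hσ p hU ⟨i, hi⟩, p.value_eq_sum_germ (F.isFrame x) hp le_rfl (F.mem x) hU hU, dotProduct,
    map_sum]
  simp only [hvalue, map_mul]
  rfl

variable {k : Type u} [Field k] (f : S ⟶ Spec (.of k))

/-- The constant functions on a scheme over a field. -/
def globalConst : k →+* Γ(S, ⊤) :=
  ((Scheme.ΓSpecIso (.of k)).inv ≫ f.appTop).hom

/-- The constants in a local ring of a scheme over a field. -/
def stalkConst (x : S) : k →+* S.presheaf.stalk x :=
  (S.presheaf.germ ⊤ x (Opens.mem_top x)).hom.comp (globalConst f)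

variable {f}

lemma specMap_fromSpecStalk_comp {x : S} {R : CommRingCat.{u}} (ρ : S.presheaf.stalk x ⟶ R) :
    (Spec.map ρ ≫ S.fromSpecStalk x) ≫ f =
      Spec.map (CommRingCat.ofHom (stalkConst f x) ≫ ρ) := by
  refine ext_of_isAffine ?_
  have happ := (appLE_top_top _ _).symm.trans
    (specMap_fromSpecStalk_appLE (Opens.mem_top x) ρ le_rfl)
  rw [Scheme.Hom.comp_appTop, happ, ← cancel_epi (Scheme.ΓSpecIso _).inv,
    ← Scheme.ΓSpecIso_inv_naturality]
  rfl

variable (hva : E.IsVeryAmple f) (F : AffineFrameCover E 2) {x y : S} {R : CommRingCat.{u}}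
  [IsLocalRing R]

include hva

lemma exists_isUnit_dotProduct_coord (ρ : S.presheaf.stalk x ⟶ R) {l : Fin 2 → R}
    (hl : ∃ i, IsUnit (l i)) : ∃ σ : Γ(E, ⊤), IsUnit ((ρ ∘ F.coord x σ) ⬝ᵥ l) := by
  obtain ⟨P, π, L, q, hP, -, n, s, φ, H, -, -⟩ := hva
  obtain ⟨p, -, ⟨V, hV, τ, hτ⟩, hglobal⟩ := exists_trivializedPoint_stalk hP F ρ hl
  obtain ⟨j, hj⟩ := exists_le_preimage_chart (p.hom ≫ φ)
  obtain ⟨σ, hσ⟩ := exists_represents_globalRes hP F (s j)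
  have hunit := isUnit_evalGlobal H p hj hτ
  rw [hglobal _ σ (hσ x)] at hunit
  exact ⟨σ, by simpa using hunit.map (Scheme.ΓSpecIso R).hom.hom⟩

lemma specMap_fromSpecStalk_eq_of_dotProduct_coord_eq {ρ : S.presheaf.stalk x ⟶ R}
    {ρ' : S.presheaf.stalk y ⟶ R}
    (hρ : CommRingCat.ofHom (stalkConst f x) ≫ ρ = CommRingCat.ofHom (stalkConst f y) ≫ ρ')
    {l l' : Fin 2 → R} (hl : ∃ i, IsUnit (l i)) (hl' : ∃ i, IsUnit (l' i))
    (h : ∀ σ : Γ(E, ⊤), (ρ ∘ F.coord x σ) ⬝ᵥ l = (ρ' ∘ F.coord y σ) ⬝ᵥ l') :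
    Spec.map ρ ≫ S.fromSpecStalk x = Spec.map ρ' ≫ S.fromSpecStalk y := by
  obtain ⟨P, π, L, q, hP, -, n, s, φ, H, hk, hφ⟩ := hva
  obtain ⟨p, hp, ⟨V, hV, τ, hτ⟩, hglobal⟩ := exists_trivializedPoint_stalk hP F ρ hl
  obtain ⟨p', hp', -, hglobal'⟩ := exists_trivializedPoint_stalk hP F ρ' hl'
  have hcomp : (p.hom ≫ φ) ≫ PSpace.toSpec k n = (p'.hom ≫ φ) ≫ PSpace.toSpec k n := by
    rw [Category.assoc, hk, Category.assoc, hk, ← Category.assoc, hp, ← Category.assoc, hp',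
      specMap_fromSpecStalk_comp, specMap_fromSpecStalk_comp, hρ]
  rw [← hp, ← hp', hom_eq_of_evalGlobal_eq H hcomp hτ fun i ↦ ?_]
  obtain ⟨σ, hσ⟩ := exists_represents_globalRes hP F (s i)
  rw [hglobal _ σ (hσ x), hglobal' _ σ (hσ y), h]

end Separation

/-! ### Exterior powers -/

section ExteriorPower

lemma alternatingMap_eq_det_smul {R M N ι : Type*} [CommRing R] [AddCommGroup M] [Module R M]
    [AddCommGroup N] [Module R N] [Fintype ι] [DecidableEq ι] (b : Module.Basis ι R M)
    (ω : M [⋀^ι]→ₗ[R] N) (m : ι → M) : ω m = b.det m • ω b := by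
  suffices h : ω = (LinearMap.toSpanSingleton R N (ω b)).compAlternatingMap b.det from
    congrArg (· m) h
  refine b.ext_alternating fun v hv ↦ ?_
  let p := Equiv.ofBijective v (Finite.injective_iff_bijective.1 hv)
  change ω (b ∘ p) = b.det (b ∘ p) • ω b
  rw [ω.map_perm, b.det.map_perm, b.det_self, Units.smul_def, Units.smul_def]
  simp [Int.cast_smul_eq_zsmul]

variable {X : Scheme.{u}} (M : X.Modules) (n : ℕ)

lemma germ_smul {V : X.Opens} {x : X} (hx : x ∈ V) (a : Γ(X, V)) (s : Γ(M, V)) :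
    M.presheaf.germ V x hx (a • s) = X.presheaf.germ V x hx a • M.presheaf.germ V x hx s :=
  PresheafOfModules.germ_smul (R := X.presheaf) (M := M.val) x V hx a s

/-- The canonical map from the exterior power of the module of sections over an open set to the
sections of the exterior power, which is a sheafification. -/
def toExteriorPower (V : X.Opens) :
    (⋀[Γ(X, V)]^n Γ(M, V)) →ₗ[Γ(X, V)] Γ(M.exteriorPower n, V) where
  toFun t := ((PresheafOfModules.sheafificationAdjunction (𝟙 X.ringCatSheaf.obj)).unit.app
    (M.exteriorPowerPresheaf n)).app (op V) t
  map_add' s t := (((PresheafOfModules.sheafificationAdjunction (𝟙 X.ringCatSheaf.obj)).unit.app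
    (M.exteriorPowerPresheaf n)).app (op V)).hom.map_add s t
  map_smul' a t := (((PresheafOfModules.sheafificationAdjunction (𝟙 X.ringCatSheaf.obj)).unit.app
    (M.exteriorPowerPresheaf n)).app (op V)).hom.map_smul a t

/-- The exterior product of sections over an open set. -/
def wedge (V : X.Opens) : Γ(M, V) [⋀^Fin n]→ₗ[Γ(X, V)] Γ(M.exteriorPower n, V) :=
  (toExteriorPower M n V).compAlternatingMap (_root_.exteriorPower.ιMulti Γ(X, V) n)

lemma wedge_res {V W : X.Opens} (i : W ⟶ V) (m : Fin n → Γ(M, V)) :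
    (M.exteriorPower n).presheaf.map i.op (wedge M n V m) =
      wedge M n W fun j ↦ M.presheaf.map i.op (m j) := by
  have h := CategoryTheory.congr_fun ((CategoryTheory.toSheafify (Opens.grothendieckTopology X)
    (M.exteriorPowerAb n)).naturality i.op) (_root_.exteriorPower.ιMulti Γ(X, V) n m)
  refine h.symm.trans ?_
  change toExteriorPower M n W (_root_.exteriorPower.mapSemilinear (X.presheaf.map i.op).hom
    (M.resₛₗ i) n (_root_.exteriorPower.ιMulti Γ(X, V) n m)) = _
  rw [_root_.exteriorPower.mapSemilinear_ιMulti]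
  rfl

lemma exists_toExteriorPower_eq {V : X.Opens} (s : Γ(M.exteriorPower n, V)) {x : X} (hx : x ∈ V) :
    ∃ (W : X.Opens) (i : W ⟶ V) (_ : x ∈ W) (t : ⋀[Γ(X, W)]^n Γ(M, W)),
      toExteriorPower M n W t = (M.exteriorPower n).presheaf.map i.op s := by
  have : Presheaf.IsLocallySurjective (Opens.grothendieckTopology X)
      (CategoryTheory.toSheafify (Opens.grothendieckTopology X) (M.exteriorPowerAb n)) :=
    inferInstance
  obtain ⟨W, i, ⟨t, ht⟩, hxW⟩ := this.imageSieve_mem (U := V) s x hx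
  exact ⟨W, i, hxW, t, ht⟩

variable {M n}

lemma exists_toExteriorPower_eq_smul_wedge {V : X.Opens}
    (b : Module.Basis (Fin n) Γ(X, V) Γ(M, V)) (t : ⋀[Γ(X, V)]^n Γ(M, V)) :
    ∃ a : Γ(X, V), toExteriorPower M n V t = a • wedge M n V b := by
  induction t using _root_.exteriorPower.induction_ιMulti with
  | h m => exact ⟨b.det m, alternatingMap_eq_det_smul b (wedge M n V) m⟩
  | h0 => exact ⟨0, by rw [map_zero, zero_smul]⟩
  | hadd x y hx hy =>
    obtain ⟨a, ha⟩ := hx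
    obtain ⟨a', ha'⟩ := hy
    exact ⟨a + a', by rw [map_add, ha, ha', add_smul]⟩
  | hsmul r x hx =>
    obtain ⟨a, ha⟩ := hx
    exact ⟨r * a, by rw [_root_.map_smul, ha, mul_smul]⟩

namespace IsFrame

variable {U : X.Opens} {e : Fin n → Γ(M, U)} (he : IsFrame M U e)

include he

lemma exists_eq_smul_germ_wedge {x : X} (hx : x ∈ U) (z : (M.exteriorPower n).presheaf.stalk x) :
    ∃ a : X.presheaf.stalk x, z = a • (M.exteriorPower n).presheaf.germ U x hx (wedge M n U e) := by
  obtain ⟨V, hxV, s, rfl⟩ := TopCat.Presheaf.exists_germ_eq _ z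
  obtain ⟨W, i, hxW, t, ht⟩ := exists_toExteriorPower_eq M n
    ((M.exteriorPower n).presheaf.map (homOfLE inf_le_left : V ⊓ U ⟶ V).op s)
    (show x ∈ V ⊓ U from ⟨hxV, hx⟩)
  have hWU : W ≤ U := i.le.trans inf_le_right
  obtain ⟨b, hb⟩ := he W hWU
  obtain ⟨a, ha⟩ := exists_toExteriorPower_eq_smul_wedge b t
  have hwedge : wedge M n W b =
      (M.exteriorPower n).presheaf.map (homOfLE hWU).op (wedge M n U e) := by
    rw [wedge_res]
    exact congrArg _ (funext hb)
  refine ⟨X.presheaf.germ W x hxW a, ?_⟩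
  rw [← TopCat.Presheaf.germ_res_apply _ (homOfLE hWU) x hxW, ← hwedge, ← germ_smul, ← ha, ht,
    TopCat.Presheaf.germ_res_apply, TopCat.Presheaf.germ_res_apply]

lemma wedge_eq_det_smul (m : Fin n → Γ(M, U)) :
    wedge M n U m = (Matrix.of fun i ↦ he.coord le_rfl (m i)).det • wedge M n U e := by
  let b := (he U le_rfl).choose
  have hb : ⇑b = e := funext fun j ↦
    ((he U le_rfl).choose_spec j).trans (CategoryTheory.congr_fun (M.presheaf.map_id _) (e j))
  rw [alternatingMap_eq_det_smul b, hb, Module.Basis.det_apply, ← Matrix.det_transpose]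
  rfl

end IsFrame

namespace AffineFrameCover

variable (F : AffineFrameCover M n) (x : X)

/-- The germ at `x` of the exterior product of the chosen frame, a generator of the stalk of the
exterior power. -/
def wedgeFrame : (M.exteriorPower n).presheaf.stalk x :=
  (M.exteriorPower n).presheaf.germ (F.opens x) x (F.mem x) (wedge M n (F.opens x) (F.frame x))

variable {x} in
lemma exists_eq_smul_wedgeFrame (z : (M.exteriorPower n).presheaf.stalk x) :
    ∃ a : X.presheaf.stalk x, z = a • F.wedgeFrame x :=
  (F.isFrame x).exists_eq_smul_germ_wedge (F.mem x) z

lemma germ_wedge (σ : Fin n → Γ(M, ⊤)) :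
    (M.exteriorPower n).presheaf.germ ⊤ x (Opens.mem_top x) (wedge M n ⊤ σ) =
      (Matrix.of fun i ↦ F.coord x (σ i)).det • F.wedgeFrame x := by
  rw [← TopCat.Presheaf.germ_res_apply _ (homOfLE le_top) x (F.mem x), wedge_res,
    (F.isFrame x).wedge_eq_det_smul, germ_smul]
  congr 1
  exact RingHom.map_det (X.presheaf.germ _ x (F.mem x)).hom _

end AffineFrameCover

end ExteriorPower

/-! ### Jets of sections of the determinant -/

section DeterminantJets

open IsLocalRing

variable {k : Type u} [Field k] {S : Scheme.{u}} (f : S ⟶ Spec (.of k)) {E : S.Modules}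

/-- The local ring at a point of a scheme over a field `k`, as an algebra over `k`. This is not an
instance, as it depends on the structure morphism. -/
abbrev stalkAlgebra (x : S) : Algebra k (S.presheaf.stalk x) :=
  (stalkConst f x).toAlgebra

/-- The global sections of a module on a scheme over a field `k`, as a vector space over `k`. This
is not an instance, as it depends on the structure morphism. -/
abbrev sectionsModule (M : S.Modules) : Module k Γ(M, ⊤) :=
  Module.compHom _ (globalConst f)

lemma nonempty_stalk_algHom [IsAlgClosed k] [LocallyOfFiniteType f] {x : S} (hx : IsClosed {x}) :
    letI := stalkAlgebra f x
    Nonempty (S.presheaf.stalk x →ₐ[k] k) := by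
  let := stalkAlgebra f x
  let v := S.residue x ≫ (residueFieldIsoBase f x hx).hom
  have hv : CommRingCat.ofHom (stalkConst f x) ≫ v = 𝟙 _ := by
    rw [← Category.assoc, ← Iso.eq_comp_inv, Category.id_comp]
    apply Spec.map_injective
    rw [SpecMap_residueFieldIsoBase_inv, ← specMap_fromSpecStalk_comp]
    rfl
  exact ⟨{ v.hom with commutes' := CategoryTheory.congr_fun hv }⟩

variable (F : AffineFrameCover E 2)

/-- The coordinates of the germ of a global section, as a map linear over the base field. -/
def AffineFrameCover.coordₗ (x : S) :
    letI := sectionsModule f E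
    letI := stalkAlgebra f x
    Γ(E, ⊤) →ₗ[k] Fin 2 → S.presheaf.stalk x :=
  letI := sectionsModule f E
  letI := stalkAlgebra f x
  { F.coord x with map_smul' a σ := F.coord_smul x (globalConst f a) σ }

variable {f} {ι : Type*} {x : ι → S}

lemma separatesPoints_coord (hva : E.IsVeryAmple f) (hx : Function.Injective x) :
    letI := sectionsModule f E
    letI := fun i ↦ stalkAlgebra f (x i)
    SeparatesPoints fun i ↦ F.coordₗ f (x i) := by
  let := sectionsModule f E
  let := fun i ↦ stalkAlgebra f (x i)
  refine ⟨fun i R _ _ _ ρ l hl ↦ exists_isUnit_dotProduct_coord (R := .of R) hva F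
    (CommRingCat.ofHom ρ.toRingHom) hl, fun {i j R} _ _ _ ρ ρ' _ _ l l' hl hl' h ↦ ?_⟩
  have hρ : CommRingCat.ofHom (stalkConst f (x i)) ≫ CommRingCat.ofHom ρ.toRingHom =
      CommRingCat.ofHom (stalkConst f (x j)) ≫ CommRingCat.ofHom ρ'.toRingHom := by
    ext a
    exact (ρ.commutes a).trans (ρ'.commutes a).symm
  have heq := (SpecToEquivOfLocalRing S (.of R)).symm.injective
    (a₁ := ⟨x i, CommRingCat.ofHom ρ.toRingHom, ⟨IsLocalHom.map_nonunit (f := ρ)⟩⟩)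
    (a₂ := ⟨x j, CommRingCat.ofHom ρ'.toRingHom, ⟨IsLocalHom.map_nonunit (f := ρ')⟩⟩)
    (specMap_fromSpecStalk_eq_of_dotProduct_coord_eq hva F hρ hl hl' h)
  obtain rfl : i = j := hx (congrArg Sigma.fst heq)
  have hhom := congrArg Subtype.val (eq_of_heq (Sigma.mk.inj heq).2)
  congr
  exact AlgHom.ext (CategoryTheory.congr_fun hhom)

variable (f x)

/-- The families of local functions `g i` at the points `x i` for which the germs
`g i • F.wedgeFrame (x i)` come from one global section of the determinant of `E`. -/
def wedgeCoefficients :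
    letI := fun i ↦ stalkAlgebra f (x i)
    Submodule k (∀ i, S.presheaf.stalk (x i)) :=
  letI := fun i ↦ stalkAlgebra f (x i)
  { carrier := {g | ∃ s : Γ(E.exteriorPower 2, ⊤), ∀ i,
      (E.exteriorPower 2).presheaf.germ ⊤ (x i) (Opens.mem_top _) s = g i • F.wedgeFrame (x i)}
    add_mem' := by
      rintro g g' ⟨s, hs⟩ ⟨s', hs'⟩
      exact ⟨s + s', fun i ↦ by rw [map_add, hs, hs', Pi.add_apply, add_smul]⟩
    zero_mem' := ⟨0, fun i ↦ by rw [map_zero, Pi.zero_apply, zero_smul]⟩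
    smul_mem' := by
      rintro a g ⟨s, hs⟩
      refine ⟨globalConst f a • s, fun i ↦ ?_⟩
      rw [germ_smul, hs, smul_smul]
      rfl }

lemma det_coord_mem_wedgeCoefficients (σ τ : Γ(E, ⊤)) :
    (fun i ↦ (Matrix.of ![F.coord (x i) σ, F.coord (x i) τ]).det) ∈ wedgeCoefficients f F x := by
  refine ⟨wedge E 2 ⊤ ![σ, τ], fun i ↦ ?_⟩
  have hpair : (fun j ↦ F.coord (x i) (![σ, τ] j)) = ![F.coord (x i) σ, F.coord (x i) τ] :=
    funext (Fin.forall_fin_two.2 ⟨rfl, rfl⟩)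
  rw [F.germ_wedge, hpair]

variable {f x}

theorem exists_germ_eq_smul_wedgeFrame [IsAlgClosed k] [LocallyOfFiniteType f] [Fintype ι]
    (hva : E.IsVeryAmple f) (hx : Function.Injective x) (hcl : ∀ i, IsClosed {x i}) {m : ι → ℕ}
    (hsum : ∑ i, m i ≤ 3) (a : ∀ i, S.presheaf.stalk (x i)) :
    ∃ (s : Γ(E.exteriorPower 2, ⊤)) (g : ∀ i, S.presheaf.stalk (x i)),
      (∀ i, (E.exteriorPower 2).presheaf.germ ⊤ (x i) (Opens.mem_top _) s =
        g i • F.wedgeFrame (x i)) ∧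
      ∀ i, a i - g i ∈ maximalIdeal (S.presheaf.stalk (x i)) ^ m i := by
  let := sectionsModule f E
  let := fun i ↦ stalkAlgebra f (x i)
  have := LocallyOfFiniteType.isLocallyNoetherian f
  have v (i : ι) := (nonempty_stalk_algHom f (hcl i)).some
  obtain ⟨g, ⟨s, hs⟩, hg⟩ := (separatesPoints_coord F hva hx).exists_forall_sub_mem_pow v
    (G := wedgeCoefficients f F x)
    (det_coord_mem_wedgeCoefficients f F x) (fun i ↦ IsNoetherian.noetherian _) hsum a
  exact ⟨s, g, hs, hg⟩

end DeterminantJets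

end VeryAmpleBundle

end

theorem mainTheorem3_general {k : Type u} [Field k] [IsAlgClosed k] {S : Scheme.{u}}
    (f : S ⟶ Spec (.of k)) [LocallyOfFiniteType f] (E : S.Modules)
    (hE : E.IsLocallyFreeOfRank 2) (hva : E.IsVeryAmple f) :
    (E.exteriorPower 2).IsJetAmple 2 := by
  intro r x m hx hcl _ hsum z
  obtain ⟨F⟩ := VeryAmpleBundle.nonempty_affineFrameCover hE
  choose z' hz' using fun i ↦ Submodule.Quotient.mk_surjective _ (z i)
  choose a ha using fun i ↦ F.exists_eq_smul_wedgeFrame (z' i)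
  obtain ⟨s, g, hs, hg⟩ :=
    VeryAmpleBundle.exists_germ_eq_smul_wedgeFrame F hva hx hcl hsum.le a
  refine ⟨s, funext fun i ↦ ?_⟩
  rw [← hz', eq_comm]
  refine (Submodule.Quotient.eq _).2 ?_
  rw [hs, ha, ← sub_smul]
  exact Submodule.smul_mem_smul (hg i) trivial

theorem mainTheorem3 {k : Type u} [Field k] [IsAlgClosed k] {S : Scheme.{u}}
    (f : S ⟶ Spec (.of k)) [SmoothOfRelativeDimension 2 f] (E : S.Modules)
    (hE : E.IsLocallyFreeOfRank 2) (hva : E.IsVeryAmple f) :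
    (E.exteriorPower 2).IsJetAmple 2 :=
  have : Smooth f := SmoothOfRelativeDimension.smooth 2 f
  mainTheorem3_general f E hE hva
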